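/- **Language.** Let $Var$ be a (finite or infinite) set of basic variables and $Pred$ a set of predicate symbols, each $P$ with an arity $ar(P)\in\mathbb N$. Formulas are given by $$\varphi ::= P x_1\ldots x_n \mid \neg\varphi \mid \varphi\wedge\varphi \mid D_X\varphi \mid K_X\varphi \mid D_XY \mid K_XY,$$ where $n=ar(P)$, $x_i\in Var$, and $X,Y$ are finite subsets of $Var$; $\varphi\to\psi$ abbreviates $\neg(\varphi\wedge\neg\psi)$. **Models.** A *topo-dependence model* consists of a set $\mathbb D_x$ with a $T_0$ topology $\tau_x$ for each $x\in Var$, a relation $I(P)$ of arity $ar(P)$ on $\bigcup_x\mathbb D_x$ for each $P\in Pred$, a set $S$ of states, and a surjection $\mathbf x:S\to\mathbb D_x$ for each $x\in Var$. For finite $X\subseteq Var$ put $\mathbf X(s)=(\mathbf x(s))_{x\in X}$, let $\mathbb D_X=\mathbf X(S)\subseteq\prod_{x\in X}\mathbb D_x$ carry the subspace topology of the product topology, and let $\tau_X^S=\{\mathbf X^{-1}(U): U \text{ open in }\mathbb D_X\}$. Truth at a state $s$ is defined by the usual Boolean clauses and: - $s\models Px_1\ldots x_n$ iff $(\mathbf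 x_1(s),\ldots,\mathbf x_n(s))\in I(P)$; - $s\models D_X\varphi$ iff $w\models\varphi$ for all $w\in S$ with $\mathbf X(w)=\mathbf X(s)$; - $s\models D_XY$ iff $\mathbf Y(w)=\mathbf Y(s)$ for all $w\in S$ with $\mathbf X(w)=\mathbf X(s)$; - $s\models K_X\varphi$ iff $s$ lies in the $\tau_X^S$-interior of $\{w\in S: w\models\varphi\}$; - $s\models K_XY$ iff there are $O\in\tau_X^S$ with $s\in O$ and a continuous $F:\mathbf X(O)\to\mathbb D_Y$ with $F\circ\mathbf X=\mathbf Y$ on $O$. A *metric dependence model* is a topo-dependence model in which each $\tau_x$ is the topology of a designated metric $d_x$ on $\mathbb D_x$. A *concrete topo-dependence model* is one in which $S\subseteq\prod_{x\in Var}\mathbb D_x$ and $\mathbf x(s)=s(x)$. A map $F$ between pseudo-metric spaces is *pseudo-locally Lipschitz* if every point $p$ of its domain has an open neighbourhood $O$, and $F(p)$ has an open neighbourhood $U$, such that $F$ is Lipschitz on $O\cap F^{-1}(U)$. A metric dependence model is *pseudo-locally Lipschitz* if for all $x,y\in Var$ with $\mathbf x$ not constant on $S$, the map $\mathbf y:(S,d_x^S)\to(\mathbb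 D_y,d_y)$ is pseudo-locally Lipschitz, where $d_x^S(s,w)=d_x(\mathbf x(s),\mathbf x(w))$. A formula is *valid* on a class of models if it is true at every state of every model of the class. **Proof system $\mathbf{LCD}$.** Axioms and rules, for all formulas $\varphi,\psi$ and finite $X,Y,Z\subseteq Var$: - all instances of propositional tautologies, and modus ponens; - from $\varphi$ infer $D_X\varphi$; $D_X(\varphi\to\psi)\to(D_X\varphi\to D_X\psi)$; $D_X\varphi\to\varphi$; $D_X\varphi\to D_XD_X\varphi$; $\neg D_X\varphi\to D_X\neg D_X\varphi$; - $D_XY$ for $Y\subseteq X$; $(D_XY\wedge D_XZ)\to D_X(Y\cup Z)$; $(D_XY\wedge D_YZ)\to D_XZ$; $D_XY\to D_XD_XY$; $D_XY\to(D_Y\varphi\to D_X\varphi)$; $Px_1\ldots x_n\to D_{\{x_1,\ldots,x_n\}}Px_1\ldots x_n$; - from $\varphi$ infer $K_X\varphi$; $K_X(\varphi\to\psi)\to(K_X\varphi\to K_X\psi)$; $K_X\varphi\to\varphi$; $K_X\varphi\to K_XK_X\varphi$; - $K_XY$ for $Y\subseteq X$; $(K_XY\wedge K_XZ)\to K_X(Y\cup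 Z)$; $(K_XY\wedge K_YZ)\to K_XZ$; $K_XY\to K_XK_XY$; $K_XY\to(K_Y\varphi\to K_X\varphi)$; - $K_X\varphi\to D_X\varphi$; $K_XY\to D_XY$; $D_\emptyset\varphi\to K_\emptyset\varphi$; $D_\emptyset Y\to K_\emptyset Y$. **Theorem.** For every formula $\varphi$ the following are equivalent: $\varphi$ is provable in $\mathbf{LCD}$; $\varphi$ is valid on (a) all topo-dependence models; (b) all metric dependence models; (c) all concrete topo-dependence models; (d) all pseudo-locally Lipschitz metric dependence models. Moreover the logic $\mathsf{LCD}$, i.e. the set of valid formulas, is decidable: if $Var$ and $Pred$ are countable and numbered by natural numbers, and formulas are coded by natural numbers accordingly, then there is a total computable function that, given the code of a formula $\varphi$, decides whether $\varphi$ is valid on all topo-dependence models. -/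

import Mathlib

universe u v w w'

namespace LCD

/-! ### Syntax -/

/-- Formulas over the basic variables `Var` and the predicate symbols `Pred` with arities `ar`:
`P x₁ … xₙ`, `¬ φ`, `φ ∧ ψ`, `D_X φ`, `K_X φ`, `D_X Y`, `K_X Y`, with `X`, `Y` finite sets. -/
inductive Formula (Var : Type u) (Pred : Type v) (ar : Pred → ℕ) : Type (max u v)
  | atom (P : Pred) (xs : Fin (ar P) → Var) : Formula Var Pred ar
  | neg (φ : Formula Var Pred ar) : Formula Var Pred ar
  | and (φ ψ : Formula Var Pred ar) : Formula Var Pred ar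
  | dmod (X : Finset Var) (φ : Formula Var Pred ar) : Formula Var Pred ar
  | kmod (X : Finset Var) (φ : Formula Var Pred ar) : Formula Var Pred ar
  | ddep (X Y : Finset Var) : Formula Var Pred ar
  | kdep (X Y : Finset Var) : Formula Var Pred ar

namespace Formula

variable {Var : Type u} {Pred : Type v} {ar : Pred → ℕ}

/-- Material implication. -/
def imp (φ ψ : Formula Var Pred ar) : Formula Var Pred ar := neg (and φ (neg ψ))

/-- `φ` is an instance of a propositional tautology: it is true under every assignment of truth
values to formulas that respects the Boolean connectives. -/
def IsTautology (φ : Formula Var Pred ar) : Prop :=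
  ∀ val : Formula Var Pred ar → Prop,
    (∀ α, val (neg α) ↔ ¬ val α) →
    (∀ α β, val (and α β) ↔ (val α ∧ val β)) → val φ

/-- Gödel numbering of formulas, from numberings of the variables and the predicate symbols. -/
def code [Encodable Var] [Encodable Pred] : Formula Var Pred ar → ℕ
  | atom P xs => Nat.pair 0 (Nat.pair (Encodable.encode P) (Encodable.encode (List.ofFn xs)))
  | neg φ => Nat.pair 1 (code φ)
  | and φ ψ => Nat.pair 2 (Nat.pair (code φ) (code ψ))
  | dmod X φ => Nat.pair 3 (Nat.pair (Encodable.encode X) (code φ))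
  | kmod X φ => Nat.pair 4 (Nat.pair (Encodable.encode X) (code φ))
  | ddep X Y => Nat.pair 5 (Nat.pair (Encodable.encode X) (Encodable.encode Y))
  | kdep X Y => Nat.pair 6 (Nat.pair (Encodable.encode X) (Encodable.encode Y))

end Formula

/-! ### The proof system -/

open Formula in
/-- Theorems of the proof system **LCD**. -/
inductive Provable {Var : Type u} {Pred : Type v} {ar : Pred → ℕ} [DecidableEq Var] :
    Formula Var Pred ar → Prop
  -- propositional logic
  | taut {φ} : IsTautology φ → Provable φ
  | modusPonens {φ ψ} : Provable (imp φ ψ) → Provable φ → Provable ψ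
  -- S5 for determination
  | dNec (X : Finset Var) {φ} : Provable φ → Provable (dmod X φ)
  | dDist (X : Finset Var) (φ ψ) :
      Provable (imp (dmod X (imp φ ψ)) (imp (dmod X φ) (dmod X ψ)))
  | dT (X : Finset Var) (φ) : Provable (imp (dmod X φ) φ)
  | d4 (X : Finset Var) (φ) : Provable (imp (dmod X φ) (dmod X (dmod X φ)))
  | d5 (X : Finset Var) (φ) : Provable (imp (neg (dmod X φ)) (dmod X (neg (dmod X φ))))
  -- exact dependence
  | dIncl (X Y : Finset Var) : Y ⊆ X → Provable (ddep X Y)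
  | dAdd (X Y Z : Finset Var) : Provable (imp (and (ddep X Y) (ddep X Z)) (ddep X (Y ∪ Z)))
  | dTrans (X Y Z : Finset Var) : Provable (imp (and (ddep X Y) (ddep Y Z)) (ddep X Z))
  | determinedDep (X Y : Finset Var) : Provable (imp (ddep X Y) (dmod X (ddep X Y)))
  | dTransfer (X Y : Finset Var) (φ) :
      Provable (imp (ddep X Y) (imp (dmod Y φ) (dmod X φ)))
  | determinedAtoms (P : Pred) (xs : Fin (ar P) → Var) :
      Provable (imp (atom P xs) (dmod (Finset.univ.image xs) (atom P xs)))
  -- S4 for knowability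
  | kNec (X : Finset Var) {φ} : Provable φ → Provable (kmod X φ)
  | kDist (X : Finset Var) (φ ψ) :
      Provable (imp (kmod X (imp φ ψ)) (imp (kmod X φ) (kmod X ψ)))
  | veracity (X : Finset Var) (φ) : Provable (imp (kmod X φ) φ)
  | posIntro (X : Finset Var) (φ) : Provable (imp (kmod X φ) (kmod X (kmod X φ)))
  -- knowable dependence
  | kIncl (X Y : Finset Var) : Y ⊆ X → Provable (kdep X Y)
  | kAdd (X Y Z : Finset Var) : Provable (imp (and (kdep X Y) (kdep X Z)) (kdep X (Y ∪ Z)))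
  | kTrans (X Y Z : Finset Var) : Provable (imp (and (kdep X Y) (kdep Y Z)) (kdep X Z))
  | knowabilityOfDep (X Y : Finset Var) : Provable (imp (kdep X Y) (kmod X (kdep X Y)))
  | kTransfer (X Y : Finset Var) (φ) :
      Provable (imp (kdep X Y) (imp (kmod Y φ) (kmod X φ)))
  -- connecting axioms
  | knowableDetermination (X : Finset Var) (φ) : Provable (imp (kmod X φ) (dmod X φ))
  | knowableDependence (X Y : Finset Var) : Provable (imp (kdep X Y) (ddep X Y))
  | knowledgeOfNecessity (φ) : Provable (imp (dmod ∅ φ) (kmod ∅ φ))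
  | knowledgeOfConstants (Y : Finset Var) : Provable (imp (ddep ∅ Y) (kdep ∅ Y))

/-! ### Models -/

/-- A typed topological model: value ranges `D x` (sets of values of an ambient type, possibly
overlapping), a topology on each, and an interpretation of each predicate symbol as a relation on
the union of the ranges. -/
structure TypedTopModel (Var : Type u) (Pred : Type v) (ar : Pred → ℕ) where
  Value : Type w
  D : Var → Set Value
  top : ∀ x, TopologicalSpace (D x)
  I : ∀ P : Pred, Set (Fin (ar P) → ↥(⋃ x, D x))

/-- A topo-dependence model: each basic variable denotes an empirical variable, i.e. a surjective
map from the states to a T₀ space. -/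
structure TopoDepModel (Var : Type u) (Pred : Type v) (ar : Pred → ℕ)
    extends TypedTopModel.{u, v, w} Var Pred ar where
  State : Type w'
  val : ∀ x, State → D x
  surj : ∀ x, Function.Surjective (val x)
  t0 : ∀ x, @T0Space (D x) (top x)

namespace TopoDepModel

variable {Var : Type u} {Pred : Type v} {ar : Pred → ℕ} (M : TopoDepModel.{u, v, w, w'} Var Pred ar)

instance (x : Var) : TopologicalSpace (M.D x) := M.top x

/-- The joint variable `𝐗 : S → ∏_{x ∈ X} D x`; its value space is `Set.range (M.joint X)` with
the subspace topology of the product topology. -/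
def joint (X : Finset Var) (s : M.State) : ∀ x : X, M.D x := fun x => M.val x s

/-- The (weak) `X`-topology on states. -/
abbrev stateTop (X : Finset Var) : TopologicalSpace M.State :=
  TopologicalSpace.induced (M.joint X) inferInstance

/-- Truth of a formula at a state. -/
def Sat : M.State → Formula Var Pred ar → Prop
  | s, .atom P xs =>
      (fun i => (⟨(M.val (xs i) s : M.Value),
        Set.mem_iUnion_of_mem (xs i) (M.val (xs i) s).2⟩ : ↥(⋃ x, M.D x))) ∈ M.I P
  | s, .neg φ => ¬ Sat s φ
  | s, .and φ ψ => Sat s φ ∧ Sat s ψ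
  | s, .dmod X φ => ∀ t, M.joint X s = M.joint X t → Sat t φ
  | s, .kmod X φ => s ∈ @interior M.State (M.stateTop X) {t | Sat t φ}
  | s, .ddep X Y => ∀ t, M.joint X s = M.joint X t → M.joint Y s = M.joint Y t
  | s, .kdep X Y => ∃ O : Set M.State, @IsOpen M.State (M.stateTop X) O ∧ s ∈ O ∧
      ∃ F : ↥(M.joint X '' O) → ↥(Set.range (M.joint Y)), Continuous F ∧
        ∀ t (ht : t ∈ O),
          F ⟨M.joint X t, Set.mem_image_of_mem _ ht⟩ = ⟨M.joint Y t, Set.mem_range_self t⟩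

/-- Truth at all states of the model. -/
def GloballyTrue (φ : Formula Var Pred ar) : Prop := ∀ s, M.Sat s φ

end TopoDepModel

/-- A metric dependence model: the value ranges carry designated metrics. -/
structure MetricDepModel (Var : Type u) (Pred : Type v) (ar : Pred → ℕ) where
  Value : Type w
  D : Var → Set Value
  metric : ∀ x, MetricSpace (D x)
  I : ∀ P : Pred, Set (Fin (ar P) → ↥(⋃ x, D x))
  State : Type w'
  val : ∀ x, State → D x
  surj : ∀ x, Function.Surjective (val x)

/-- `F` is pseudo-locally Lipschitz: every point `x` has an open neighbourhood `O`, and `F x` an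
open neighbourhood `U`, such that `F` is Lipschitz on `O ∩ F⁻¹(U)`. -/
def PseudoLocallyLipschitz {D E : Type*} [PseudoMetricSpace D] [PseudoMetricSpace E]
    (F : D → E) : Prop :=
  ∀ x, ∃ O : Set D, IsOpen O ∧ x ∈ O ∧ ∃ U : Set E, IsOpen U ∧ F x ∈ U ∧
    ∃ C : NNReal, LipschitzOnWith C F (O ∩ F ⁻¹' U)

namespace MetricDepModel

variable {Var : Type u} {Pred : Type v} {ar : Pred → ℕ}
  (M : MetricDepModel.{u, v, w, w'} Var Pred ar)

instance (x : Var) : MetricSpace (M.D x) := M.metric x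

/-- The underlying topo-dependence model, with the metric topologies. -/
def toTopoDepModel : TopoDepModel.{u, v, w, w'} Var Pred ar where
  Value := M.Value
  D := M.D
  top := fun _ => inferInstance
  I := M.I
  State := M.State
  val := M.val
  surj := M.surj
  t0 := fun _ => inferInstance

/-- The pseudo-metric `d_x^S(s, t) = d_x(𝐱(s), 𝐱(t))` on states. -/
abbrev statePseudoMetric (x : Var) : PseudoMetricSpace M.State :=
  PseudoMetricSpace.induced (M.val x) inferInstance

/-- `𝐱` takes the same value at all states. -/
def IsConstant (x : Var) : Prop := ∀ s t, M.val x s = M.val x t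

/-- Pseudo-locally Lipschitz models: for all basic variables `x`, `y` with `𝐱` not constant, the map
`𝐲 : (S, d_x^S) → (D y, d_y)` is pseudo-locally Lipschitz. A constant `𝐱` carries the same zero
pseudo-metric as the empty joint variable and, like that one, imposes no condition. -/
def IsPseudoLocallyLipschitz : Prop :=
  ∀ x y : Var, ¬ M.IsConstant x →
    @PseudoLocallyLipschitz M.State (M.D y) (M.statePseudoMetric x) inferInstance (M.val y)

end MetricDepModel

/-- A concrete topo-dependence model: the states are assignments of values to variables. -/
structure ConcreteModel (Var : Type u) (Pred : Type v) (ar : Pred → ℕ)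
    extends TypedTopModel.{u, v, w} Var Pred ar where
  states : Set (∀ x, D x)
  surj : ∀ x (d : D x), ∃ s ∈ states, s x = d
  t0 : ∀ x, @T0Space (D x) (top x)

/-- A concrete model as a topo-dependence model, with `𝐱(s) = s(x)`. -/
def ConcreteModel.toTopoDepModel {Var : Type u} {Pred : Type v} {ar : Pred → ℕ}
    (M : ConcreteModel.{u, v, w} Var Pred ar) : TopoDepModel.{u, v, w, max u w} Var Pred ar where
  toTypedTopModel := M.toTypedTopModel
  State := M.states
  val := fun x s => s.1 x
  surj := fun x d => let ⟨s, hs, h⟩ := M.surj x d; ⟨⟨s, hs⟩, h⟩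
  t0 := M.t0

/-! ### Validity on the four classes of models -/

section Validity

variable {Var : Type u} {Pred : Type v} {ar : Pred → ℕ}

def ValidTopo (φ : Formula Var Pred ar) : Prop :=
  ∀ M : TopoDepModel.{u, v, w, w'} Var Pred ar, M.GloballyTrue φ

def ValidMetric (φ : Formula Var Pred ar) : Prop :=
  ∀ M : MetricDepModel.{u, v, w, w'} Var Pred ar, M.toTopoDepModel.GloballyTrue φ

def ValidConcrete (φ : Formula Var Pred ar) : Prop :=
  ∀ M : ConcreteModel.{u, v, w} Var Pred ar, M.toTopoDepModel.GloballyTrue φ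

def ValidPseudoLocallyLipschitz (φ : Formula Var Pred ar) : Prop :=
  ∀ M : MetricDepModel.{u, v, w, w'} Var Pred ar, M.IsPseudoLocallyLipschitz →
    M.toTopoDepModel.GloballyTrue φ

end Validity

end LCD

/-!
Soundness compares the neighbourhood filters of the topologies `τ_X^S`: `K_X Y` holds at `s` if and
only if, at all states near `s` in `τ_X^S`, these filters are finer than those of `τ_Y^S`.

For completeness, a formula that is not provable is refuted in a finite relational premodel,
obtained by filtration from maximal consistent sets: `D_X` is interpreted by an equivalence,
`K_X` by a preorder, and the dependence statements are primitive data. The premodel is unravelled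
into the tree of its histories. Each variable gives a length to every edge: `0` if the step keeps
its value, `1 / (e + 2)` if the step only changes it slightly, and `1` otherwise; the number `e` is
part of the step. The largest length of an edge on a path is then an ultrametric on the histories.
The resulting metric model has the same truths, and is pseudo-locally Lipschitz because an edge that
is shorter than `1` for one variable is at least as long for every variable that is not constant.

For decidability, the premodel can be taken of a size bounded by a primitive recursive function of
the code of the formula, so that it is coded by a natural number below a computable bound; being the
code of a refutation is a primitive recursive property of such numbers.
-/

namespace LCD

open Filter Topology

/-! ### Soundness -/

namespace TopoDepModel

section Semantics

variable {Var : Type u} {Pred : Type v} {ar : Pred → ℕ}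
  (M : TopoDepModel.{u, v, w, w'} Var Pred ar)

/-- The filter of neighbourhoods of a state in the `X`-topology `τ_X^S`. -/
def nhdsAt (X : Finset Var) (s : M.State) : Filter M.State := @nhds M.State (M.stateTop X) s

variable {M} {X Y : Finset Var} {s t : M.State} {p : M.State → Prop}

theorem joint_eq_iff : M.joint X s = M.joint X t ↔ ∀ x ∈ X, M.val x s = M.val x t :=
  ⟨fun h x hx => congrFun h ⟨x, hx⟩, fun h => funext fun x => h x.1 x.2⟩

theorem joint_empty_eq (s t : M.State) : M.joint ∅ s = M.joint ∅ t :=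
  joint_eq_iff.2 fun x hx => absurd hx (Finset.notMem_empty x)

theorem nhdsAt_eq_comap (X : Finset Var) (s : M.State) :
    M.nhdsAt X s = comap (M.joint X) (𝓝 (M.joint X s)) :=
  nhds_induced _ _

theorem nhdsAt_congr (h : M.joint X s = M.joint X t) : M.nhdsAt X s = M.nhdsAt X t := by
  rw [nhdsAt_eq_comap, nhdsAt_eq_comap, h]

theorem eventually_eventually_nhdsAt :
    (∀ᶠ t in M.nhdsAt X s, ∀ᶠ t' in M.nhdsAt X t, p t') ↔ ∀ᶠ t in M.nhdsAt X s, p t :=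
  @eventually_eventually_nhds _ (M.stateTop X) _ _

theorem self_of_eventually_nhdsAt (h : ∀ᶠ t in M.nhdsAt X s, p t) : p s :=
  @Eventually.self_of_nhds _ (M.stateTop X) _ _ h

theorem eventually_nhdsAt_of_joint_eq (h : ∀ᶠ t in M.nhdsAt X s, p t)
    (hst : M.joint X s = M.joint X t) : p t :=
  self_of_eventually_nhdsAt (X := X) (nhdsAt_congr hst ▸ h)

theorem nhdsAt_eq_iInf (X : Finset Var) (s : M.State) :
    M.nhdsAt X s = ⨅ x ∈ X, comap (M.val x) (𝓝 (M.val x s)) := by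
  rw [nhdsAt_eq_comap, nhds_pi, Filter.pi, comap_iInf, iInf_subtype']
  exact iInf_congr fun x => comap_comap

theorem nhdsAt_anti (h : Y ⊆ X) (s : M.State) : M.nhdsAt X s ≤ M.nhdsAt Y s := by
  simpa only [nhdsAt_eq_iInf] using biInf_mono h

theorem nhdsAt_union [DecidableEq Var] (X Y : Finset Var) (s : M.State) :
    M.nhdsAt (X ∪ Y) s = M.nhdsAt X s ⊓ M.nhdsAt Y s := by
  simpa only [nhdsAt_eq_iInf] using Finset.iInf_union

theorem nhdsAt_le_iff_tendsto :
    M.nhdsAt X s ≤ M.nhdsAt Y s ↔ Tendsto (M.joint Y) (M.nhdsAt X s) (𝓝 (M.joint Y s)) := by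
  rw [nhdsAt_eq_comap Y, tendsto_iff_comap]

/-- The value spaces are T₀, so continuity of `𝐘` with respect to `𝐗` at two states with the same
value of `𝐗` makes their values of `𝐘` inseparable, hence equal. -/
theorem joint_eq_of_nhdsAt_le (hs : M.nhdsAt X s ≤ M.nhdsAt Y s)
    (ht : M.nhdsAt X t ≤ M.nhdsAt Y t) (h : M.joint X s = M.joint X t) :
    M.joint Y s = M.joint Y t := by
  have := M.t0
  have specializes_of_le {s t : M.State} (hs : M.nhdsAt X s ≤ M.nhdsAt Y s)
      (h : M.joint X s = M.joint X t) : M.joint Y t ⤳ M.joint Y s :=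
    specializes_iff_forall_open.2 fun U hU hsU =>
      eventually_nhdsAt_of_joint_eq ((nhdsAt_le_iff_tendsto.1 hs).eventually (hU.mem_nhds hsU)) h
  exact ((specializes_of_le ht h.symm).antisymm (specializes_of_le hs h)).eq

theorem sat_imp {φ ψ : Formula Var Pred ar} :
    M.Sat s (.imp φ ψ) ↔ (M.Sat s φ → M.Sat s ψ) := by
  simp [Formula.imp, Sat]

theorem sat_atom_congr {P : Pred} {xs : Fin (ar P) → Var}
    (h : ∀ i, M.val (xs i) s = M.val (xs i) t) : M.Sat s (.atom P xs) ↔ M.Sat t (.atom P xs) := by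
  simp only [Sat, h]

theorem sat_kmod {φ : Formula Var Pred ar} :
    M.Sat s (.kmod X φ) ↔ ∀ᶠ t in M.nhdsAt X s, M.Sat t φ :=
  @mem_interior_iff_mem_nhds _ (M.stateTop X) _ _

theorem eventually_nhdsAt_le_of_sat_kdep (h : M.Sat s (.kdep X Y)) :
    ∀ᶠ t in M.nhdsAt X s, M.nhdsAt X t ≤ M.nhdsAt Y t := by
  let _ := M.stateTop X
  obtain ⟨O, hO, hs, F, hF, hFY⟩ := h
  have continuousOn_joint : ContinuousOn (M.joint Y) O := by
    refine continuousOn_iff_continuous_domRestrict.2 <| (continuous_subtype_val.comp <| hF.comp <|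
      (continuous_induced_dom.comp continuous_subtype_val).subtype_mk
        fun t => Set.mem_image_of_mem (M.joint X) t.2).congr fun t => ?_
    exact congrArg Subtype.val (hFY t t.2)
  exact mem_of_superset (hO.mem_nhds hs) fun t ht =>
    nhdsAt_le_iff_tendsto.2 (continuousOn_joint.continuousAt (hO.mem_nhds ht))

/-- The restriction of `𝐗` to `O` is a quotient map onto its image, because the topology of the
states is induced by `𝐗`; so `𝐘` descends along it. -/
theorem exists_continuous_factor {O : Set M.State}
    (hO : ∀ t ∈ O, M.nhdsAt X t ≤ M.nhdsAt Y t) :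
    ∃ F : M.joint X '' O → Set.range (M.joint Y), Continuous F ∧ ∀ t (ht : t ∈ O),
      F ⟨M.joint X t, Set.mem_image_of_mem _ ht⟩ = ⟨M.joint Y t, Set.mem_range_self t⟩ := by
  let _ := M.stateTop X
  have continuous_joint : Continuous (M.joint X) := continuous_induced_dom
  let q : C(O, M.joint X '' O) :=
    ⟨fun t => ⟨M.joint X t, Set.mem_image_of_mem _ t.2⟩,
      (continuous_joint.comp continuous_subtype_val).subtype_mk _⟩
  let g : C(O, Set.range (M.joint Y)) :=
    ⟨fun t => ⟨M.joint Y t, Set.mem_range_self _⟩,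
      (continuousOn_iff_continuous_domRestrict.1 fun t ht =>
        (nhdsAt_le_iff_tendsto.1 (hO t ht)).mono_left nhdsWithin_le_nhds).subtype_mk _⟩
  have q_surjective : Function.Surjective q := by
    rintro ⟨_, t, ht, rfl⟩
    exact ⟨⟨t, ht⟩, rfl⟩
  have q_inducing : IsInducing q :=
    .of_comp q.continuous continuous_subtype_val
      ((IsInducing.induced (M.joint X)).comp .subtypeVal)
  have g_factors : Function.FactorsThrough g q := fun t t' h =>
    Subtype.ext (joint_eq_of_nhdsAt_le (hO t t.2) (hO t' t'.2) (congrArg Subtype.val h))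
  have hq := q_inducing.isQuotientMap_of_surjective q_surjective
  exact ⟨hq.lift g g_factors, (hq.lift g g_factors).continuous,
    fun t ht => DFunLike.congr_fun (hq.lift_comp g g_factors) ⟨t, ht⟩⟩

theorem sat_kdep :
    M.Sat s (.kdep X Y) ↔ ∀ᶠ t in M.nhdsAt X s, M.nhdsAt X t ≤ M.nhdsAt Y t := by
  refine ⟨eventually_nhdsAt_le_of_sat_kdep, fun h => ?_⟩
  obtain ⟨O, hOY, hO, hs⟩ := (@eventually_nhds_iff _ (M.stateTop X) _ _).1 h
  exact ⟨O, hO, hs, exists_continuous_factor hOY⟩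

theorem sat_kdep_trans {Z : Finset Var} (hXY : M.Sat s (.kdep X Y)) (hYZ : M.Sat s (.kdep Y Z)) :
    M.Sat s (.kdep X Z) := by
  rw [sat_kdep] at *
  filter_upwards [hXY, self_of_eventually_nhdsAt hXY hYZ] with t using le_trans

theorem sat_ddep_of_sat_kdep (h : M.Sat s (.kdep X Y)) : M.Sat s (.ddep X Y) :=
  have h := sat_kdep.1 h
  fun _ ht => joint_eq_of_nhdsAt_le (self_of_eventually_nhdsAt h)
    (eventually_nhdsAt_of_joint_eq h ht) ht

theorem sat_kdep_empty_of_sat_ddep_empty (h : M.Sat s (.ddep ∅ Y)) : M.Sat s (.kdep ∅ Y) := by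
  have joint_eq (t t' : M.State) : M.joint Y t = M.joint Y t' :=
    (h t (joint_empty_eq s t)).symm.trans (h t' (joint_empty_eq s t'))
  refine sat_kdep.2 (.of_forall fun t => nhdsAt_le_iff_tendsto.2 ?_)
  exact tendsto_const_nhds.congr fun t' => joint_eq t t'

theorem sat_of_provable [DecidableEq Var] {φ : Formula Var Pred ar} (h : Provable φ)
    (s : M.State) : M.Sat s φ := by
  induction h generalizing s with
  | taut h => exact h (M.Sat s) (fun _ => .rfl) (fun _ _ => .rfl)
  | modusPonens _ _ ih₁ ih₂ => exact sat_imp.1 (ih₁ s) (ih₂ s)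
  | dNec X _ ih => exact fun t _ => ih t
  | kNec X _ ih => exact sat_kmod.2 (.of_forall ih)
  | dIncl X Y hYX =>
    exact fun t ht => joint_eq_iff.2 fun y hy => joint_eq_iff.1 ht y (hYX hy)
  | kIncl X Y hYX => exact sat_kdep.2 (.of_forall (nhdsAt_anti hYX))
  | dDist X φ ψ =>
    exact sat_imp.2 fun h => sat_imp.2 fun hφ t ht => sat_imp.1 (h t ht) (hφ t ht)
  | dT X φ => exact sat_imp.2 fun h => h s rfl
  | d4 X φ => exact sat_imp.2 fun h t ht t' ht' => h t' (ht.trans ht')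
  | d5 X φ => exact sat_imp.2 fun h t ht h' => h fun t' ht' => h' t' (ht.symm.trans ht')
  | dAdd X Y Z =>
    exact sat_imp.2 fun ⟨hY, hZ⟩ t ht => joint_eq_iff.2 fun z hz =>
      (Finset.mem_union.1 hz).elim (joint_eq_iff.1 (hY t ht) z) (joint_eq_iff.1 (hZ t ht) z)
  | dTrans X Y Z => exact sat_imp.2 fun ⟨hY, hZ⟩ t ht => hZ t (hY t ht)
  | determinedDep X Y =>
    exact sat_imp.2 fun h t ht t' ht' => (h t ht).symm.trans (h t' (ht.trans ht'))
  | dTransfer X Y φ => exact sat_imp.2 fun h => sat_imp.2 fun hφ t ht => hφ t (h t ht)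
  | determinedAtoms P xs =>
    exact sat_imp.2 fun h t ht => (sat_atom_congr fun i => joint_eq_iff.1 ht (xs i) (by simp)).1 h
  | kDist X φ ψ =>
    simp only [sat_imp, sat_kmod]
    exact fun h hφ => hφ.mp h
  | veracity X φ => exact sat_imp.2 fun h => self_of_eventually_nhdsAt (sat_kmod.1 h)
  | posIntro X φ => simp only [sat_imp, sat_kmod, eventually_eventually_nhdsAt, imp_self]
  | kAdd X Y Z =>
    refine sat_imp.2 fun ⟨hY, hZ⟩ => sat_kdep.2 ?_
    simpa only [nhdsAt_union, le_inf_iff] using (sat_kdep.1 hY).and (sat_kdep.1 hZ)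
  | kTrans X Y Z => exact sat_imp.2 fun ⟨hY, hZ⟩ => sat_kdep_trans hY hZ
  | knowabilityOfDep X Y =>
    simp only [sat_imp, sat_kmod, sat_kdep, eventually_eventually_nhdsAt, imp_self]
  | kTransfer X Y φ =>
    simp only [sat_imp, sat_kmod, sat_kdep]
    exact fun h hφ => self_of_eventually_nhdsAt h hφ
  | knowableDetermination X φ =>
    exact sat_imp.2 fun h t ht => eventually_nhdsAt_of_joint_eq (sat_kmod.1 h) ht
  | knowableDependence X Y => exact sat_imp.2 sat_ddep_of_sat_kdep
  | knowledgeOfNecessity φ =>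
    exact sat_imp.2 fun h => sat_kmod.2 (.of_forall fun t => h t (joint_empty_eq s t))
  | knowledgeOfConstants Y => exact sat_imp.2 sat_kdep_empty_of_sat_ddep_empty

end Semantics

/-! ### Concrete models -/

section Concrete

variable {Var : Type u} {Pred : Type v} {ar : Pred → ℕ}
  (M : TopoDepModel.{u, v, w, w'} Var Pred ar)

/-- The concrete model obtained by identifying states with the same values of all variables. -/
def toConcrete : ConcreteModel.{u, v, w} Var Pred ar where
  toTypedTopModel := M.toTypedTopModel
  states := Set.range fun s x => M.val x s
  surj := fun x d => by
    obtain ⟨s, rfl⟩ := M.surj x d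
    exact ⟨_, ⟨s, rfl⟩, rfl⟩
  t0 := M.t0

/-- The assignment of values to variables at a state. -/
def assignment (s : M.State) : M.toConcrete.toTopoDepModel.State :=
  ⟨fun x => M.val x s, s, rfl⟩

variable {M}

theorem assignment_surjective : Function.Surjective M.assignment := by
  rintro ⟨_, s, rfl⟩
  exact ⟨s, rfl⟩

theorem comap_nhdsAt_assignment (X : Finset Var) (s : M.State) :
    comap M.assignment (M.toConcrete.toTopoDepModel.nhdsAt X (M.assignment s)) = M.nhdsAt X s := by
  rw [nhdsAt_eq_comap, nhdsAt_eq_comap, comap_comap]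
  rfl

theorem map_nhdsAt_assignment (X : Finset Var) (s : M.State) :
    map M.assignment (M.nhdsAt X s) = M.toConcrete.toTopoDepModel.nhdsAt X (M.assignment s) := by
  rw [← comap_nhdsAt_assignment, map_comap_of_surjective assignment_surjective]

theorem sat_assignment {φ : Formula Var Pred ar} {s : M.State} :
    M.toConcrete.toTopoDepModel.Sat (M.assignment s) φ ↔ M.Sat s φ := by
  induction φ generalizing s with
  | atom P xs => exact .rfl
  | neg φ ih => exact not_congr ih
  | and φ ψ ih₁ ih₂ => exact and_congr ih₁ ih₂
  | dmod X φ ih =>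
    exact assignment_surjective.forall.trans <| forall_congr' fun _ => imp_congr .rfl ih
  | kmod X φ ih => simp only [sat_kmod, ← map_nhdsAt_assignment, eventually_map, ih]
  | ddep X Y => exact assignment_surjective.forall
  | kdep X Y =>
    simp only [sat_kdep, ← map_nhdsAt_assignment X, eventually_map]
    simp only [map_le_iff_le_comap, comap_nhdsAt_assignment]

end Concrete

end TopoDepModel

open Formula

/-! ### Maximal consistent sets -/

section MaximalConsistentSets

variable {Var : Type u} {Pred : Type v} {ar : Pred → ℕ}

/-- Assignments of truth values to formulas that respect the Boolean connectives, as in the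
definition of tautologies. -/
structure IsBooleanValuation (val : Formula Var Pred ar → Prop) : Prop where
  neg : ∀ α, val (neg α) ↔ ¬ val α
  and : ∀ α β, val (and α β) ↔ val α ∧ val β

namespace IsBooleanValuation

variable {val : Formula Var Pred ar → Prop} (h : IsBooleanValuation val)
include h

theorem imp (α β : Formula Var Pred ar) : val (imp α β) ↔ (val α → val β) := by
  simp [Formula.imp, h.neg, h.and]

theorem foldr_imp (L : List (Formula Var Pred ar)) (β : Formula Var Pred ar) :
    val (L.foldr Formula.imp β) ↔ ((∀ α ∈ L, val α) → val β) := by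
  induction L with
  | nil => simp
  | cons α L ih => simp only [List.foldr_cons, h.imp, ih, List.forall_mem_cons, and_imp]

end IsBooleanValuation

theorem isTautology_iff {φ : Formula Var Pred ar} :
    IsTautology φ ↔ ∀ val : Formula Var Pred ar → Prop, IsBooleanValuation val → val φ :=
  ⟨fun h val hval => h val hval.neg hval.and, fun h val hn ha => h val ⟨hn, ha⟩⟩

variable [DecidableEq Var]

/-- `ψ` is derivable from the hypotheses `T`. -/
def Derivable (T : Set (Formula Var Pred ar)) (ψ : Formula Var Pred ar) : Prop :=
  ∃ L : List (Formula Var Pred ar), (∀ α ∈ L, α ∈ T) ∧ Provable (L.foldr imp ψ)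

theorem derivable_empty_iff {ψ : Formula Var Pred ar} :
    Derivable (∅ : Set (Formula Var Pred ar)) ψ ↔ Provable ψ := by
  refine ⟨fun ⟨L, hL, h⟩ => ?_, fun h => ⟨[], by simp, h⟩⟩
  obtain rfl : L = [] := List.eq_nil_iff_forall_not_mem.2 hL
  exact h

namespace Derivable

variable {T : Set (Formula Var Pred ar)} {α β γ ψ : Formula Var Pred ar}

theorem of_provable (h : Provable ψ) : Derivable T ψ := ⟨[], by simp, h⟩

theorem of_mem (h : ψ ∈ T) : Derivable T ψ :=
  ⟨[ψ], by simpa using h, .taut <| isTautology_iff.2 fun val hval => by simp [hval.imp]⟩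

theorem of_valuation (hα : Derivable T α) (hβ : Derivable T β)
    (h : ∀ val : Formula Var Pred ar → Prop, IsBooleanValuation val → val α → val β → val γ) :
    Derivable T γ := by
  obtain ⟨L₁, hL₁, h₁⟩ := hα
  obtain ⟨L₂, hL₂, h₂⟩ := hβ
  refine ⟨L₁ ++ L₂, fun a ha => (List.mem_append.1 ha).elim (hL₁ a) (hL₂ a), ?_⟩
  refine .modusPonens (.modusPonens (.taut <| isTautology_iff.2 fun val hval => ?_) h₁) h₂
  simp only [hval.imp, hval.foldr_imp, List.forall_mem_append]
  exact fun h₁ h₂ hL => h val hval (h₁ hL.1) (h₂ hL.2)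

theorem mp (hαβ : Derivable T (imp α β)) (hα : Derivable T α) : Derivable T β :=
  hαβ.of_valuation hα fun _ hval => (hval.imp α β).1

theorem deduction (h : Derivable (insert α T) β) : Derivable T (imp α β) := by
  classical
  obtain ⟨L, hL, h⟩ := h
  refine ⟨L.filter (· ≠ α), fun a ha => ?_,
    .modusPonens (.taut <| isTautology_iff.2 fun val hval => ?_) h⟩
  · obtain ⟨haL, hne⟩ := List.mem_filter.1 ha
    exact (hL a haL).resolve_left (of_decide_eq_true hne)
  · simp only [hval.imp, hval.foldr_imp]
    intro hβ hfilter hα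
    refine hβ fun a ha => ?_
    by_cases e : a = α
    · exact e ▸ hα
    · exact hfilter a (List.mem_filter.2 ⟨ha, decide_eq_true e⟩)

end Derivable

/-- Maximal consistent sets, described as Boolean valuations that make all theorems true. -/
structure IsMCS (Γ : Set (Formula Var Pred ar)) : Prop extends
    IsBooleanValuation (· ∈ Γ) where
  mem_of_provable : ∀ {α}, Provable α → α ∈ Γ

theorem IsMCS.mp {Γ : Set (Formula Var Pred ar)} (h : IsMCS Γ) {α β : Formula Var Pred ar}
    (hp : Provable (.imp α β)) (hα : α ∈ Γ) : β ∈ Γ :=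
  (h.imp α β).1 (h.mem_of_provable hp) hα

theorem exists_maximal_not_derivable {T : Set (Formula Var Pred ar)} {ψ : Formula Var Pred ar}
    (h : ¬ Derivable T ψ) : ∃ Γ, T ⊆ Γ ∧ Maximal (fun T => ¬ Derivable T ψ) Γ := by
  refine zorn_subset_nonempty {T | ¬ Derivable T ψ} (fun c hc hcc hne => ?_) T h
  refine ⟨⋃₀ c, ?_, fun s hs => Set.subset_sUnion_of_mem hs⟩
  rintro ⟨L, hL, hp⟩
  obtain ⟨t, htc, ht⟩ := DirectedOn.exists_mem_subset_of_finite_of_subset_sUnion hne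
    hcc.directedOn L.finite_toSet hL
  exact hc htc ⟨L, ht, hp⟩

theorem isMCS_of_maximal {Γ : Set (Formula Var Pred ar)} {ψ : Formula Var Pred ar}
    (hΓ : Maximal (fun T => ¬ Derivable T ψ) Γ) : IsMCS Γ := by
  have imp_of_notMem {α} (hα : α ∉ Γ) : Derivable Γ (.imp α ψ) := by
    by_contra hd
    exact hα (hΓ.2 (fun h => hd h.deduction) (Set.subset_insert _ _) (Set.mem_insert _ _))
  have mem_of_derivable {α} (hα : Derivable Γ α) : α ∈ Γ := by
    by_contra hn
    exact hΓ.1 ((imp_of_notMem hn).mp hα)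
  refine ⟨⟨fun α => ⟨fun hn hα => ?_, fun hα => ?_⟩, fun α β => ⟨fun h => ⟨?_, ?_⟩, fun h => ?_⟩⟩,
    fun hp => mem_of_derivable (.of_provable hp)⟩
  · refine hΓ.1 (Derivable.of_valuation (.of_mem hn) (.of_mem hα) fun val hval hn hα => ?_)
    exact absurd hα ((hval.neg α).1 hn)
  · by_contra hn
    refine hΓ.1 (Derivable.of_valuation (imp_of_notMem hn) (imp_of_notMem hα) fun val hval => ?_)
    rw [hval.imp, hval.imp, hval.neg]
    exact fun hn hα => by_contra fun hψ => hψ (hn fun h => hψ (hα h))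
  · exact mem_of_derivable (Derivable.of_valuation (.of_mem h) (.of_mem h)
      fun val hval h _ => ((hval.and α β).1 h).1)
  · exact mem_of_derivable (Derivable.of_valuation (.of_mem h) (.of_mem h)
      fun val hval h _ => ((hval.and α β).1 h).2)
  · exact mem_of_derivable (Derivable.of_valuation (.of_mem h.1) (.of_mem h.2)
      fun val hval hα hβ => (hval.and α β).2 ⟨hα, hβ⟩)

theorem exists_isMCS {T : Set (Formula Var Pred ar)} {ψ : Formula Var Pred ar}
    (h : ¬ Derivable T ψ) : ∃ Γ, IsMCS Γ ∧ T ⊆ Γ ∧ ψ ∉ Γ :=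
  have ⟨Γ, hTΓ, hΓ⟩ := exists_maximal_not_derivable h
  ⟨Γ, isMCS_of_maximal hΓ, hTΓ, fun hψ => hΓ.1 (.of_mem hψ)⟩

theorem exists_isMCS_notMem {φ : Formula Var Pred ar} (h : ¬ Provable φ) :
    ∃ Γ, IsMCS Γ ∧ φ ∉ Γ :=
  have ⟨Γ, hΓ, _, hφ⟩ := exists_isMCS (mt derivable_empty_iff.1 h)
  ⟨Γ, hΓ, hφ⟩

theorem IsMCS.exists_successor {Γ : Set (Formula Var Pred ar)} (hΓ : IsMCS Γ)
    (box : Formula Var Pred ar → Formula Var Pred ar)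
    (nec : ∀ {α}, Provable α → Provable (box α))
    (dist : ∀ α β, Provable (.imp (box (.imp α β)) (.imp (box α) (box β))))
    {ψ : Formula Var Pred ar} (h : box ψ ∉ Γ) :
    ∃ Δ, IsMCS Δ ∧ (∀ α, box α ∈ Γ → α ∈ Δ) ∧ ψ ∉ Δ := by
  have box_mem_of_foldr (L : List (Formula Var Pred ar)) (hL : ∀ α ∈ L, box α ∈ Γ)
      (hm : box (L.foldr Formula.imp ψ) ∈ Γ) : box ψ ∈ Γ := by
    induction L with
    | nil => exact hm
    | cons α L ih =>
      rw [List.forall_mem_cons] at hL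
      exact ih hL.2 ((hΓ.imp _ _).1 (hΓ.mp (dist _ _) hm) hL.1)
  exact exists_isMCS (T := {α | box α ∈ Γ}) fun ⟨L, hL, hp⟩ =>
    h (box_mem_of_foldr L hL (hΓ.mem_of_provable (nec hp)))

end MaximalConsistentSets

/-! ### Relational premodels -/

namespace Formula

variable {Var : Type u} {Pred : Type v} {ar : Pred → ℕ}

/-- The immediate subformulas of a formula. -/
def children : Formula Var Pred ar → Set (Formula Var Pred ar)
  | neg φ | dmod _ φ | kmod _ φ => {φ}
  | and φ ψ => {φ, ψ}
  | atom _ _ | ddep _ _ | kdep _ _ => ∅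

/-- The subformulas of a formula, itself included. -/
def subformulas : Formula Var Pred ar → Set (Formula Var Pred ar)
  | neg φ => insert (neg φ) φ.subformulas
  | and φ ψ => insert (and φ ψ) (φ.subformulas ∪ ψ.subformulas)
  | dmod X φ => insert (dmod X φ) φ.subformulas
  | kmod X φ => insert (kmod X φ) φ.subformulas
  | φ => {φ}

/-- `S` contains the subformulas of its members. -/
def SubformulaClosed (S : Set (Formula Var Pred ar)) : Prop := ∀ φ ∈ S, φ.children ⊆ S

theorem mem_subformulas_self (φ : Formula Var Pred ar) : φ ∈ φ.subformulas := by
  cases φ <;> simp [subformulas]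

theorem finite_subformulas (φ : Formula Var Pred ar) : φ.subformulas.Finite := by
  induction φ with
  | neg φ ih | dmod X φ ih | kmod X φ ih => exact ih.insert _
  | and φ ψ ih₁ ih₂ => exact (ih₁.union ih₂).insert _
  | atom | ddep | kdep => exact Set.finite_singleton _

theorem subformulaClosed_subformulas (φ : Formula Var Pred ar) :
    SubformulaClosed φ.subformulas := by
  have insert_closed {S : Set (Formula Var Pred ar)} {ψ} (hS : SubformulaClosed S)
      (hψ : ψ.children ⊆ S) : SubformulaClosed (insert ψ S) := by
    rintro α (rfl | hα)
    · exact hψ.trans (Set.subset_insert _ _)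
    · exact (hS α hα).trans (Set.subset_insert _ _)
  induction φ with
  | neg φ ih | dmod X φ ih | kmod X φ ih =>
    exact insert_closed ih (Set.singleton_subset_iff.2 φ.mem_subformulas_self)
  | and φ ψ ih₁ ih₂ =>
    refine insert_closed (fun α hα => ?_)
      (Set.insert_subset (.inl φ.mem_subformulas_self)
        (Set.singleton_subset_iff.2 (.inr ψ.mem_subformulas_self)))
    exact hα.elim (fun h => (ih₁ α h).trans Set.subset_union_left)
      (fun h => (ih₂ α h).trans Set.subset_union_right)
  | atom | ddep | kdep =>
    rintro _ rfl
    exact Set.empty_subset _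

variable [DecidableEq Var]

/-- The set of variables determining the truth value of an atom or of a dependence statement, or
restricting a modality. -/
def source : Formula Var Pred ar → Finset Var
  | atom _ xs => Finset.univ.image xs
  | dmod X _ | kmod X _ | ddep X _ | kdep X _ => X
  | neg _ | and _ _ => ∅

/-- The set of dependent variables `Y` of a dependence statement `D_X Y` or `K_X Y`. -/
def target : Formula Var Pred ar → Finset Var
  | ddep _ Y | kdep _ Y => Y
  | _ => ∅

/-- The variables occurring in a formula. -/
def vars : Formula Var Pred ar → Finset Var
  | neg φ => φ.vars
  | and φ ψ => φ.vars ∪ ψ.vars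
  | dmod X φ | kmod X φ => X ∪ φ.vars
  | φ => φ.source ∪ φ.target

theorem source_union_target_subset_vars (φ : Formula Var Pred ar) :
    φ.source ∪ φ.target ⊆ φ.vars := by
  cases φ <;> simp [source, target, vars]

theorem vars_subset_of_mem_subformulas {φ ψ : Formula Var Pred ar} (h : ψ ∈ φ.subformulas) :
    ψ.vars ⊆ φ.vars := by
  induction φ with
  | neg φ ih => exact h.elim (· ▸ subset_rfl) ih
  | dmod X φ ih | kmod X φ ih =>
    exact h.elim (· ▸ subset_rfl) fun h => (ih h).trans Finset.subset_union_right
  | and φ ψ ih₁ ih₂ =>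
    rcases h with rfl | h | h
    · rfl
    · exact (ih₁ h).trans Finset.subset_union_left
    · exact (ih₂ h).trans Finset.subset_union_right
  | atom | ddep | kdep => rw [Set.mem_singleton_iff.1 h]

end Formula

/-- The relational data of a premodel with worlds `W`: for a set of variables with index `β : B`,
`eqv β` stands for equality and `le β` for closeness of its values, while the dependence statements
`D_X y` and `K_X y` are primitive relations `dD` and `dK`. Sets of variables are given by indices,
so that the same notion serves finite models and their codes by natural numbers. -/
structure RelFrame (B V W : Type*) where
  mem : V → B → Prop
  empty : B
  eqv : B → W → W → Prop
  le : B → W → W → Prop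
  dD : W → B → V → Prop
  dK : W → B → V → Prop

namespace RelFrame

/-- The laws of relational premodels: those of an equivalence relation and a preorder, and the
axioms on dependence statements. -/
structure IsLawful {B V W : Type*} (F : RelFrame B V W) : Prop where
  not_mem_empty : ∀ y, ¬ F.mem y F.empty
  eqv_refl : ∀ X a, F.eqv X a a
  eqv_symm : ∀ X a b, F.eqv X a b → F.eqv X b a
  eqv_trans : ∀ X a b c, F.eqv X a b → F.eqv X b c → F.eqv X a c
  eqv_empty : ∀ a b, F.eqv F.empty a b
  le_of_eqv : ∀ X a b, F.eqv X a b → F.le X a b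
  le_trans : ∀ X a b c, F.le X a b → F.le X b c → F.le X a c
  dD_of_mem : ∀ X y a, F.mem y X → F.dD a X y
  dD_trans : ∀ X Y z a, (∀ y, F.mem y Y → F.dD a X y) → F.dD a Y z → F.dD a X z
  dD_of_eqv : ∀ X y a b, F.eqv X a b → F.dD a X y → F.dD b X y
  eqv_of_dD : ∀ X Y a b, (∀ y, F.mem y Y → F.dD a X y) → F.eqv X a b → F.eqv Y a b
  dK_of_mem : ∀ X y a, F.mem y X → F.dK a X y
  dK_trans : ∀ X Y z a, (∀ y, F.mem y Y → F.dK a X y) → F.dK a Y z → F.dK a X z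
  dK_of_le : ∀ X y a b, F.le X a b → F.dK a X y → F.dK b X y
  le_of_dK : ∀ X Y a b, (∀ y, F.mem y Y → F.dK a X y) → F.le X a b → F.le Y a b
  dD_of_dK : ∀ X y a, F.dK a X y → F.dD a X y
  dK_empty : ∀ y a, F.dD a F.empty y → F.dK a F.empty y

/-- Transport of a frame along a map of indices and a relation between variables. -/
def comap {B V B' V' W : Type*} (F : RelFrame B V W) (f : B' → B) (ν : V' → V → Prop)
    (mem : V' → B' → Prop) (empty : B') : RelFrame B' V' W where
  mem := mem
  empty := empty
  eqv X a b := F.eqv (f X) a b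
  le X a b := F.le (f X) a b
  dD a X x := ∀ y, ν x y → F.dD a (f X) y
  dK a X x := ∀ y, ν x y → F.dK a (f X) y

theorem IsLawful.comap {B V B' V' W : Type*} {F : RelFrame B V W} (hF : F.IsLawful) {f : B' → B}
    {ν : V' → V → Prop} {mem : V' → B' → Prop} {empty : B'}
    (hmem : ∀ y X, F.mem y (f X) ↔ ∃ x, mem x X ∧ ν x y) (hempty : f empty = F.empty)
    (not_mem_empty : ∀ x, ¬ mem x empty) : (F.comap f ν mem empty).IsLawful where
  not_mem_empty := not_mem_empty
  eqv_refl _ := hF.eqv_refl _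
  eqv_symm _ := hF.eqv_symm _
  eqv_trans _ := hF.eqv_trans _
  eqv_empty := by simpa only [RelFrame.comap, hempty] using hF.eqv_empty
  le_of_eqv _ := hF.le_of_eqv _
  le_trans _ := hF.le_trans _
  dD_of_mem X x a hx y hy := hF.dD_of_mem _ _ _ ((hmem y X).2 ⟨x, hx, hy⟩)
  dD_trans X Y z a h hz y hy := hF.dD_trans _ _ _ _
    (fun y hy => have ⟨x, hx, hxy⟩ := (hmem y Y).1 hy; h x hx y hxy) (hz y hy)
  dD_of_eqv X x a b hab h y hy := hF.dD_of_eqv _ _ _ _ hab (h y hy)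
  eqv_of_dD X Y a b h := hF.eqv_of_dD _ _ _ _
    (fun y hy => have ⟨x, hx, hxy⟩ := (hmem y Y).1 hy; h x hx y hxy)
  dK_of_mem X x a hx y hy := hF.dK_of_mem _ _ _ ((hmem y X).2 ⟨x, hx, hy⟩)
  dK_trans X Y z a h hz y hy := hF.dK_trans _ _ _ _
    (fun y hy => have ⟨x, hx, hxy⟩ := (hmem y Y).1 hy; h x hx y hxy) (hz y hy)
  dK_of_le X x a b hab h y hy := hF.dK_of_le _ _ _ _ hab (h y hy)
  le_of_dK X Y a b h := hF.le_of_dK _ _ _ _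
    (fun y hy => have ⟨x, hx, hxy⟩ := (hmem y Y).1 hy; h x hx y hxy)
  dD_of_dK X x a h y hy := hF.dD_of_dK _ _ _ (h y hy)
  dK_empty x a h y hy := by
    simp only [RelFrame.comap, hempty] at h ⊢
    exact hF.dK_empty _ _ (h y hy)

section Truth

variable {Var : Type u} {Pred : Type v} {ar : Pred → ℕ} {B W : Type*}
  (F : RelFrame B Var W) (tr : W → Formula Var Pred ar → Prop)

/-- The truth condition of a formula in a frame, where `β` is an index of its source. Atoms are only
required to be determined by their variables. -/
def TruthClause (β : B) : Formula Var Pred ar → Prop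
  | atom P xs => ∀ a b, F.eqv β a b → tr a (atom P xs) → tr b (atom P xs)
  | neg φ => ∀ a, tr a (neg φ) ↔ ¬ tr a φ
  | .and φ ψ => ∀ a, tr a (.and φ ψ) ↔ tr a φ ∧ tr a ψ
  | dmod X φ => ∀ a, tr a (dmod X φ) ↔ ∀ b, F.eqv β a b → tr b φ
  | kmod X φ => ∀ a, tr a (kmod X φ) ↔ ∀ b, F.le β a b → tr b φ
  | ddep X Y => ∀ a, tr a (ddep X Y) ↔ ∀ y ∈ Y, F.dD a β y
  | kdep X Y => ∀ a, tr a (kdep X Y) ↔ ∀ y ∈ Y, F.dK a β y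

/-- A relational premodel for the formulas in `S`: a lawful frame, with a truth assignment
satisfying the truth conditions of the formulas in `S`. -/
structure IsPremodel [DecidableEq Var] (S : Set (Formula Var Pred ar)) : Prop where
  isLawful : F.IsLawful
  closed : SubformulaClosed S
  truthClause : ∀ φ ∈ S, ∃ β, (∀ x, F.mem x β ↔ x ∈ φ.source) ∧ F.TruthClause tr β φ

end Truth

end RelFrame

/-! ### The filtrated canonical premodel -/

section FiltrationSet

variable {Var : Type u} {Pred : Type v} {ar : Pred → ℕ} {B : Type*}

/-- The formulas in `S`, and the dependence statements between the sets `ι β` and the variables in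
`V`. -/
def filtrationSet (V : Finset Var) (ι : B → Finset Var) (S : Set (Formula Var Pred ar)) :
    Set (Formula Var Pred ar) :=
  S ∪ (Set.range (fun p : B × V => ddep (ι p.1) {p.2.1}) ∪
    Set.range (fun p : B × V => kdep (ι p.1) {p.2.1}))

theorem finite_filtrationSet [Finite B] (V : Finset Var) (ι : B → Finset Var)
    {S : Set (Formula Var Pred ar)} (hS : S.Finite) : (filtrationSet V ι S).Finite :=
  hS.union ((Set.finite_range _).union (Set.finite_range _))

theorem ncard_filtrationSet_le [Finite B] (V : Finset Var) (ι : B → Finset Var)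
    (S : Set (Formula Var Pred ar)) :
    (filtrationSet V ι S).ncard ≤ S.ncard + 2 * (Nat.card B * V.card) := by
  have ncard_range_le (f : B × V → Formula Var Pred ar) :
      (Set.range f).ncard ≤ Nat.card B * V.card := by
    rw [← Set.image_univ]
    refine (Set.ncard_image_le).trans_eq ?_
    rw [Set.ncard_univ, Nat.card_prod, Nat.card_eq_fintype_card (α := V), Fintype.card_coe]
  rw [two_mul]
  exact (Set.ncard_union_le _ _).trans <| Nat.add_le_add_left ((Set.ncard_union_le _ _).trans <|
    Nat.add_le_add (ncard_range_le _) (ncard_range_le _)) _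

end FiltrationSet

section Filtration

variable {Var : Type u} {Pred : Type v} {ar : Pred → ℕ} [DecidableEq Var]

/-- `α` is provably determined by the variables in `Z`. -/
def Determined (Z : Finset Var) (α : Formula Var Pred ar) : Prop := Provable (imp α (dmod Z α))

/-- `α` is provably knowable from the variables in `Z`. -/
def Knowable (Z : Finset Var) (α : Formula Var Pred ar) : Prop := Provable (imp α (kmod Z α))

theorem Provable.imp_trans {α β γ : Formula Var Pred ar} (h₁ : Provable (imp α β))
    (h₂ : Provable (imp β γ)) : Provable (imp α γ) := by
  refine .modusPonens (.modusPonens (.taut <| isTautology_iff.2 fun val hval => ?_) h₁) h₂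
  simp only [hval.imp]
  exact fun h₁ h₂ h => h₂ (h₁ h)

theorem Provable.contrapose {α β : Formula Var Pred ar} (h : Provable (imp α β)) :
    Provable (imp (neg β) (neg α)) := by
  refine .modusPonens (.taut <| isTautology_iff.2 fun val hval => ?_) h
  simp only [hval.imp, hval.neg]
  exact mt

theorem Knowable.determined {Z : Finset Var} {α : Formula Var Pred ar} (h : Knowable Z α) :
    Determined Z α :=
  h.imp_trans (.knowableDetermination Z α)

theorem Determined.neg {Z : Finset Var} {α : Formula Var Pred ar} (h : Determined Z α) :
    Determined Z (neg α) :=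
  ((Provable.dT Z α).contrapose.imp_trans (.d5 Z α)).imp_trans
    (.modusPonens (.dDist Z _ _) (.dNec Z h.contrapose))

namespace IsMCS

variable {Γ Δ : Set (Formula Var Pred ar)} {X Y Z : Finset Var} {y : Var}
  {α : Formula Var Pred ar}

theorem ddep_of_subset (hΓ : IsMCS Γ) (h : Y ⊆ X) : ddep X Y ∈ Γ :=
  hΓ.mem_of_provable (.dIncl X Y h)

theorem kdep_of_subset (hΓ : IsMCS Γ) (h : Y ⊆ X) : kdep X Y ∈ Γ :=
  hΓ.mem_of_provable (.kIncl X Y h)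

theorem ddep_trans (hΓ : IsMCS Γ) (h₁ : ddep X Y ∈ Γ) (h₂ : ddep Y Z ∈ Γ) : ddep X Z ∈ Γ :=
  hΓ.mp (.dTrans X Y Z) ((hΓ.and _ _).2 ⟨h₁, h₂⟩)

theorem kdep_trans (hΓ : IsMCS Γ) (h₁ : kdep X Y ∈ Γ) (h₂ : kdep Y Z ∈ Γ) : kdep X Z ∈ Γ :=
  hΓ.mp (.kTrans X Y Z) ((hΓ.and _ _).2 ⟨h₁, h₂⟩)

theorem ddep_iff (hΓ : IsMCS Γ) : ddep X Y ∈ Γ ↔ ∀ y ∈ Y, ddep X {y} ∈ Γ := by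
  refine ⟨fun h y hy => hΓ.ddep_trans h (hΓ.ddep_of_subset (Finset.singleton_subset_iff.2 hy)), ?_⟩
  induction Y using Finset.induction_on with
  | empty => exact fun _ => hΓ.ddep_of_subset (Finset.empty_subset _)
  | insert y Y _ ih =>
    rw [Finset.forall_mem_insert, Finset.insert_eq]
    exact fun h => hΓ.mp (.dAdd _ _ _) ((hΓ.and _ _).2 ⟨h.1, ih h.2⟩)

theorem kdep_iff (hΓ : IsMCS Γ) : kdep X Y ∈ Γ ↔ ∀ y ∈ Y, kdep X {y} ∈ Γ := by
  refine ⟨fun h y hy => hΓ.kdep_trans h (hΓ.kdep_of_subset (Finset.singleton_subset_iff.2 hy)), ?_⟩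
  induction Y using Finset.induction_on with
  | empty => exact fun _ => hΓ.kdep_of_subset (Finset.empty_subset _)
  | insert y Y _ ih =>
    rw [Finset.forall_mem_insert, Finset.insert_eq]
    exact fun h => hΓ.mp (.kAdd _ _ _) ((hΓ.and _ _).2 ⟨h.1, ih h.2⟩)

theorem dmod_of_ddep (hΓ : IsMCS Γ) (h : ddep X Z ∈ Γ) (hα : dmod Z α ∈ Γ) : dmod X α ∈ Γ :=
  (hΓ.imp _ _).1 (hΓ.mp (.dTransfer X Z α) h) hα

theorem kmod_of_kdep (hΓ : IsMCS Γ) (h : kdep X Z ∈ Γ) (hα : kmod Z α ∈ Γ) : kmod X α ∈ Γ :=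
  (hΓ.imp _ _).1 (hΓ.mp (.kTransfer X Z α) h) hα

theorem mem_iff_of_dmod (hΓ : IsMCS Γ) (hΔ : IsMCS Δ) (h : ∀ α, dmod X α ∈ Γ → α ∈ Δ)
    (hZ : ddep X Z ∈ Γ) (hα : Determined Z α) : α ∈ Γ ↔ α ∈ Δ := by
  refine ⟨fun hm => h _ (hΓ.dmod_of_ddep hZ (hΓ.mp hα hm)), fun hm => ?_⟩
  by_contra hn
  exact (hΔ.neg α).1 (h _ (hΓ.dmod_of_ddep hZ (hΓ.mp hα.neg ((hΓ.neg α).2 hn)))) hm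

theorem dmod_empty_iff (hΓ : IsMCS Γ) (hΔ : IsMCS Δ) (h : ∀ α, dmod ∅ α ∈ Γ → α ∈ Δ) :
    dmod ∅ α ∈ Γ ↔ dmod ∅ α ∈ Δ :=
  hΓ.mem_iff_of_dmod hΔ h (hΓ.ddep_of_subset subset_rfl) (.d4 ∅ α)

end IsMCS

/-- Agreement on the formulas of `Φ` determined by what `X` determines. -/
def CanonEqv (V : Finset Var) (Φ : Set (Formula Var Pred ar)) (X : Finset Var)
    (Γ Δ : Set (Formula Var Pred ar)) : Prop :=
  ∀ Z ⊆ V, ddep X Z ∈ Γ → ∀ α ∈ Φ, Determined Z α → (α ∈ Γ ↔ α ∈ Δ)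

/-- Preservation of the formulas of `Φ` knowable from what is knowably determined by `X`. -/
def CanonLe (V : Finset Var) (Φ : Set (Formula Var Pred ar)) (X : Finset Var)
    (Γ Δ : Set (Formula Var Pred ar)) : Prop :=
  ∀ Z ⊆ V, kdep X Z ∈ Γ → ∀ α ∈ Φ, Knowable Z α → α ∈ Γ → α ∈ Δ

section Canonical

variable {V X Y : Finset Var} {Φ Γ Δ Θ : Set (Formula Var Pred ar)} {α : Formula Var Pred ar}

namespace CanonEqv

theorem mem_iff (h : CanonEqv V Φ X Γ Δ) (hΓ : IsMCS Γ) (hX : X ⊆ V) (hα : α ∈ Φ)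
    (hd : Determined X α) : α ∈ Γ ↔ α ∈ Δ :=
  h X hX (hΓ.ddep_of_subset subset_rfl) α hα hd

theorem ddep_iff (h : CanonEqv V Φ X Γ Δ) (hΓ : IsMCS Γ) (hΔ : IsMCS Δ) (hX : X ⊆ V)
    (hΦ : ∀ y ∈ Y, ddep X {y} ∈ Φ) : ddep X Y ∈ Γ ↔ ddep X Y ∈ Δ := by
  rw [hΓ.ddep_iff, hΔ.ddep_iff]
  exact forall₂_congr fun y hy => h.mem_iff hΓ hX (hΦ y hy) (.determinedDep X {y})

theorem symm (h : CanonEqv V Φ X Γ Δ) (hΓ : IsMCS Γ) (hΔ : IsMCS Δ) (hX : X ⊆ V)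
    (hΦ : ∀ y ∈ V, ddep X {y} ∈ Φ) : CanonEqv V Φ X Δ Γ :=
  fun Z hZV hZ α hα hd =>
    (h Z hZV ((h.ddep_iff hΓ hΔ hX fun y hy => hΦ y (hZV hy)).2 hZ) α hα hd).symm

theorem trans (h₁ : CanonEqv V Φ X Γ Δ) (h₂ : CanonEqv V Φ X Δ Θ) (hΓ : IsMCS Γ) (hΔ : IsMCS Δ)
    (hX : X ⊆ V) (hΦ : ∀ y ∈ V, ddep X {y} ∈ Φ) : CanonEqv V Φ X Γ Θ :=
  fun Z hZV hZ α hα hd => (h₁ Z hZV hZ α hα hd).trans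
    (h₂ Z hZV ((h₁.ddep_iff hΓ hΔ hX fun y hy => hΦ y (hZV hy)).1 hZ) α hα hd)

theorem canonLe (h : CanonEqv V Φ X Γ Δ) (hΓ : IsMCS Γ) : CanonLe V Φ X Γ Δ :=
  fun Z hZV hZ α hα hk => (h Z hZV (hΓ.mp (.knowableDependence X Z) hZ) α hα hk.determined).1

theorem of_ddep (h : CanonEqv V Φ X Γ Δ) (hΓ : IsMCS Γ) (hXY : ddep X Y ∈ Γ) :
    CanonEqv V Φ Y Γ Δ :=
  fun Z hZV hZ => h Z hZV (hΓ.ddep_trans hXY hZ)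

end CanonEqv

namespace CanonLe

theorem mem (h : CanonLe V Φ X Γ Δ) (hΓ : IsMCS Γ) (hX : X ⊆ V) (hα : α ∈ Φ)
    (hk : Knowable X α) (hm : α ∈ Γ) : α ∈ Δ :=
  h X hX (hΓ.kdep_of_subset subset_rfl) α hα hk hm

theorem kdep_mem (h : CanonLe V Φ X Γ Δ) (hΓ : IsMCS Γ) (hΔ : IsMCS Δ) (hX : X ⊆ V)
    (hΦ : ∀ y ∈ Y, kdep X {y} ∈ Φ) (hXY : kdep X Y ∈ Γ) : kdep X Y ∈ Δ := by
  rw [hΔ.kdep_iff]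
  rw [hΓ.kdep_iff] at hXY
  exact fun y hy => h.mem hΓ hX (hΦ y hy) (.knowabilityOfDep X {y}) (hXY y hy)

theorem trans (h₁ : CanonLe V Φ X Γ Δ) (h₂ : CanonLe V Φ X Δ Θ) (hΓ : IsMCS Γ) (hΔ : IsMCS Δ)
    (hX : X ⊆ V) (hΦ : ∀ y ∈ V, kdep X {y} ∈ Φ) : CanonLe V Φ X Γ Θ :=
  fun Z hZV hZ α hα hk hm =>
    h₂ Z hZV (h₁.kdep_mem hΓ hΔ hX (fun y hy => hΦ y (hZV hy)) hZ) α hα hk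
      (h₁ Z hZV hZ α hα hk hm)

theorem of_kdep (h : CanonLe V Φ X Γ Δ) (hΓ : IsMCS Γ) (hXY : kdep X Y ∈ Γ) : CanonLe V Φ Y Γ Δ :=
  fun Z hZV hZ => h Z hZV (hΓ.kdep_trans hXY hZ)

end CanonLe

end Canonical

/-- A family of maximal consistent sets that represents, up to the formulas of `Φ`, all maximal
consistent sets with the same global facts. -/
structure IsCanonicalFamily {W : Type*} (Φ : Set (Formula Var Pred ar))
    (g : W → Set (Formula Var Pred ar)) : Prop where
  isMCS : ∀ a, IsMCS (g a)
  mem_of_dmod_empty : ∀ a b α, dmod ∅ α ∈ g a → α ∈ g b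
  exists_eq_on : ∀ a Δ, IsMCS Δ → (∀ α, dmod ∅ α ∈ g a → α ∈ Δ) →
    ∃ b, ∀ α ∈ Φ, α ∈ g b ↔ α ∈ Δ

section CanonicalFamily

variable {W : Type*} {Φ : Set (Formula Var Pred ar)} {g : W → Set (Formula Var Pred ar)}
  {V X : Finset Var} {φ : Formula Var Pred ar}

theorem IsCanonicalFamily.dmod_mem_iff (hg : IsCanonicalFamily Φ g) (hX : X ⊆ V)
    (hmem : dmod X φ ∈ Φ) (hφ : φ ∈ Φ) (a : W) :
    dmod X φ ∈ g a ↔ ∀ b, CanonEqv V Φ X (g a) (g b) → φ ∈ g b := by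
  have hga := hg.isMCS a
  refine ⟨fun h b hb => (hg.isMCS b).mp (.dT X φ) ((hb.mem_iff hga hX hmem (.d4 X φ)).1 h),
    fun h => ?_⟩
  by_contra hn
  obtain ⟨Δ, hΔ, hΔX, hφΔ⟩ := hga.exists_successor (dmod X) (.dNec X) (.dDist X) hn
  obtain ⟨b, hb⟩ := hg.exists_eq_on a Δ hΔ fun α hα =>
    hΔX α (hga.dmod_of_ddep (hga.ddep_of_subset (Finset.empty_subset X)) hα)
  refine hφΔ ((hb φ hφ).1 (h b fun Z _ hZ α hα hd => ?_))
  rw [hb α hα]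
  exact hga.mem_iff_of_dmod hΔ hΔX hZ hd

theorem IsCanonicalFamily.kmod_mem_iff (hg : IsCanonicalFamily Φ g) (hX : X ⊆ V)
    (hmem : kmod X φ ∈ Φ) (hφ : φ ∈ Φ) (a : W) :
    kmod X φ ∈ g a ↔ ∀ b, CanonLe V Φ X (g a) (g b) → φ ∈ g b := by
  have hga := hg.isMCS a
  refine ⟨fun h b hb => (hg.isMCS b).mp (.veracity X φ) (hb.mem hga hX hmem (.posIntro X φ) h),
    fun h => ?_⟩
  by_contra hn
  obtain ⟨Δ, hΔ, hΔX, hφΔ⟩ := hga.exists_successor (kmod X) (.kNec X) (.kDist X) hn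
  obtain ⟨b, hb⟩ := hg.exists_eq_on a Δ hΔ fun α hα =>
    hΔX α (hga.kmod_of_kdep (hga.kdep_of_subset (Finset.empty_subset X))
      (hga.mp (.knowledgeOfNecessity α) hα))
  refine hφΔ ((hb φ hφ).1 (h b fun Z _ hZ α hα hk hαa => ?_))
  rw [hb α hα]
  exact hΔX α (hga.kmod_of_kdep hZ (hga.mp hk hαa))

end CanonicalFamily

section CanonicalFrame

variable {B W : Type*}

/-- The canonical frame over a family `g` of maximal consistent sets. Variables outside `V` count as
constants. -/
def canonicalFrame (V : Finset Var) (ι : B → Finset Var) (empty : B)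
    (Φ : Set (Formula Var Pred ar)) (g : W → Set (Formula Var Pred ar)) : RelFrame B Var W where
  mem y β := y ∈ ι β
  empty := empty
  eqv β a b := CanonEqv V Φ (ι β) (g a) (g b)
  le β a b := CanonLe V Φ (ι β) (g a) (g b)
  dD a β y := y ∈ V → ddep (ι β) {y} ∈ g a
  dK a β y := y ∈ V → kdep (ι β) {y} ∈ g a

variable {V : Finset Var} {ι : B → Finset Var} {empty : B} {S : Set (Formula Var Pred ar)}
  {g : W → Set (Formula Var Pred ar)}

theorem isLawful_canonicalFrame (hg : IsCanonicalFamily (filtrationSet V ι S) g)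
    (hι : ∀ β, ι β ⊆ V) (hempty : ι empty = ∅) :
    (canonicalFrame V ι empty (filtrationSet V ι S) g).IsLawful := by
  have ddep_mem (β) : ∀ y ∈ V, ddep (ι β) {y} ∈ filtrationSet V ι S :=
    fun y hy => .inr (.inl ⟨(β, ⟨y, hy⟩), rfl⟩)
  have kdep_mem (β) : ∀ y ∈ V, kdep (ι β) {y} ∈ filtrationSet V ι S :=
    fun y hy => .inr (.inr ⟨(β, ⟨y, hy⟩), rfl⟩)
  have ddep_of_dD {β γ a} (h : ∀ y ∈ ι γ, y ∈ V → ddep (ι β) {y} ∈ g a) : ddep (ι β) (ι γ) ∈ g a :=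
    (hg.isMCS a).ddep_iff.2 fun y hy => h y hy (hι γ hy)
  have kdep_of_dK {β γ a} (h : ∀ y ∈ ι γ, y ∈ V → kdep (ι β) {y} ∈ g a) : kdep (ι β) (ι γ) ∈ g a :=
    (hg.isMCS a).kdep_iff.2 fun y hy => h y hy (hι γ hy)
  exact
  { not_mem_empty := fun y => by simp [canonicalFrame, hempty]
    eqv_refl := fun _ _ _ _ _ _ _ _ => .rfl
    eqv_symm := fun β a b h => h.symm (hg.isMCS a) (hg.isMCS b) (hι β) (ddep_mem β)
    eqv_trans := fun β a b c h₁ h₂ => h₁.trans h₂ (hg.isMCS a) (hg.isMCS b) (hι β) (ddep_mem β)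
    eqv_empty := fun a b Z _ hZ α _ hα =>
      (hg.isMCS a).mem_iff_of_dmod (hg.isMCS b) (hg.mem_of_dmod_empty a b) (hempty ▸ hZ) hα
    le_of_eqv := fun β a b h => h.canonLe (hg.isMCS a)
    le_trans := fun β a b c h₁ h₂ => h₁.trans h₂ (hg.isMCS a) (hg.isMCS b) (hι β) (kdep_mem β)
    dD_of_mem := fun β y a hy _ => (hg.isMCS a).ddep_of_subset (Finset.singleton_subset_iff.2 hy)
    dD_trans := fun β γ z a h hz hzV => (hg.isMCS a).ddep_trans (ddep_of_dD h) (hz hzV)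
    dD_of_eqv := fun β y a b h hy hyV => (h.mem_iff (hg.isMCS a) (hι β) (ddep_mem β y hyV)
      (.determinedDep _ _)).1 (hy hyV)
    eqv_of_dD := fun β γ a b h hab => hab.of_ddep (hg.isMCS a) (ddep_of_dD h)
    dK_of_mem := fun β y a hy _ => (hg.isMCS a).kdep_of_subset (Finset.singleton_subset_iff.2 hy)
    dK_trans := fun β γ z a h hz hzV => (hg.isMCS a).kdep_trans (kdep_of_dK h) (hz hzV)
    dK_of_le := fun β y a b h hy hyV => h.mem (hg.isMCS a) (hι β) (kdep_mem β y hyV)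
      (.knowabilityOfDep _ _) (hy hyV)
    le_of_dK := fun β γ a b h hab => hab.of_kdep (hg.isMCS a) (kdep_of_dK h)
    dD_of_dK := fun β y a h hyV => (hg.isMCS a).mp (.knowableDependence _ _) (h hyV)
    dK_empty := fun y a h hyV => by
      simp only [canonicalFrame, hempty] at h ⊢
      exact (hg.isMCS a).mp (.knowledgeOfConstants _) (h hyV) }

theorem truthClause_canonicalFrame (hg : IsCanonicalFamily (filtrationSet V ι S) g)
    (hι : ∀ β, ι β ⊆ V) {φ : Formula Var Pred ar} (hφ : φ ∈ S) (hchildren : φ.children ⊆ S)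
    (htarget : φ.target ⊆ V) {β : B} (hβ : ι β = φ.source) :
    (canonicalFrame V ι empty (filtrationSet V ι S) g).TruthClause (fun a α => α ∈ g a) β φ := by
  have hsource : φ.source ⊆ V := hβ ▸ hι β
  have hφ' : φ ∈ filtrationSet V ι S := .inl hφ
  cases φ with
  | atom P xs =>
    intro a b (h : CanonEqv V _ (ι β) (g a) (g b))
    rw [hβ] at h
    exact (h.mem_iff (hg.isMCS a) hsource hφ' (.determinedAtoms P xs)).1
  | neg φ => exact fun a => (hg.isMCS a).neg φ
  | and φ ψ => exact fun a => (hg.isMCS a).and φ ψ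
  | dmod X φ =>
    simp only [RelFrame.TruthClause, canonicalFrame, hβ]
    exact hg.dmod_mem_iff hsource hφ' (.inl (hchildren rfl))
  | kmod X φ =>
    simp only [RelFrame.TruthClause, canonicalFrame, hβ]
    exact hg.kmod_mem_iff hsource hφ' (.inl (hchildren rfl))
  | ddep X Y =>
    change ι β = X at hβ
    simp only [RelFrame.TruthClause, canonicalFrame, hβ]
    exact fun a => (hg.isMCS a).ddep_iff.trans
      (forall₂_congr fun y hy => ⟨fun h _ => h, fun h => h (htarget hy)⟩)
  | kdep X Y =>
    change ι β = X at hβ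
    simp only [RelFrame.TruthClause, canonicalFrame, hβ]
    exact fun a => (hg.isMCS a).kdep_iff.trans
      (forall₂_congr fun y hy => ⟨fun h _ => h, fun h => h (htarget hy)⟩)

theorem isPremodel_canonicalFrame (hg : IsCanonicalFamily (filtrationSet V ι S) g)
    (hι : ∀ β, ι β ⊆ V) (hempty : ι empty = ∅) (hS : SubformulaClosed S)
    (htarget : ∀ φ ∈ S, φ.target ⊆ V) (hsource : ∀ φ ∈ S, ∃ β, ι β = φ.source) :
    (canonicalFrame V ι empty (filtrationSet V ι S) g).IsPremodel (fun a α => α ∈ g a) S where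
  isLawful := isLawful_canonicalFrame hg hι hempty
  closed := hS
  truthClause φ hφ :=
    have ⟨β, hβ⟩ := hsource φ hφ
    ⟨β, fun x => by rw [← hβ]; rfl,
      truthClause_canonicalFrame hg hι hφ (hS φ hφ) (htarget φ hφ) hβ⟩

end CanonicalFrame

theorem exists_fin_representatives {C A : Type*} [Nonempty C] [Finite A] (r : C → A) {N : ℕ}
    (hN : Nat.card A ≤ N) : ∃ c : Fin N → C, ∀ x, ∃ i, r (c i) = r x := by
  have := Fintype.ofFinite A
  have : Nonempty (A ↪ Fin N) :=
    Function.Embedding.nonempty_of_card_le (by simpa [Nat.card_eq_fintype_card] using hN)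
  obtain ⟨e⟩ := this
  classical
  refine ⟨fun i => if h : ∃ x, e (r x) = i then h.choose else Classical.arbitrary C, fun x => ?_⟩
  have h : ∃ y, e (r y) = e (r x) := ⟨x, rfl⟩
  exact ⟨e (r x), by simpa only [dif_pos h] using e.injective h.choose_spec⟩

theorem exists_isCanonicalFamily {Φ : Set (Formula Var Pred ar)} (hΦ : Φ.Finite) {N : ℕ}
    (hN : 2 ^ Φ.ncard ≤ N) {φ : Formula Var Pred ar} (hφΦ : φ ∈ Φ) (hφ : ¬ Provable φ) :
    ∃ g : Fin N → Set (Formula Var Pred ar), IsCanonicalFamily Φ g ∧ ∃ a, φ ∉ g a := by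
  obtain ⟨Γ, hΓ, hφΓ⟩ := exists_isMCS_notMem hφ
  let C := {Δ : Set (Formula Var Pred ar) // IsMCS Δ ∧ ∀ α, dmod ∅ α ∈ Γ → α ∈ Δ}
  have : Nonempty C := ⟨Γ, hΓ, fun α => hΓ.mp (.dT ∅ α)⟩
  have : Finite Φ := hΦ
  obtain ⟨c, hc⟩ := exists_fin_representatives (fun Δ : C => {α : Φ | α.1 ∈ Δ.1}) (N := N) (by
    have := Fintype.ofFinite Φ
    rw [Nat.card_eq_fintype_card, Fintype.card_set]
    rwa [← Nat.card_coe_set_eq, Nat.card_eq_fintype_card] at hN)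
  have exists_rep (Δ : C) : ∃ i, ∀ α ∈ Φ, α ∈ (c i).1 ↔ α ∈ Δ.1 :=
    (hc Δ).imp fun i hi α hα => Set.ext_iff.1 hi ⟨α, hα⟩
  have dmod_iff (i α) : dmod ∅ α ∈ Γ ↔ dmod ∅ α ∈ (c i).1 :=
    hΓ.dmod_empty_iff (c i).2.1 (c i).2.2
  refine ⟨fun i => (c i).1, ⟨fun i => (c i).2.1, fun i j α hα => ?_, fun i Δ hΔ hiΔ => ?_⟩, ?_⟩
  · exact (c j).2.2 α ((dmod_iff i α).2 hα)
  · exact exists_rep ⟨Δ, hΔ, fun α hα => hiΔ α ((dmod_iff i α).1 hα)⟩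
  · obtain ⟨i, hi⟩ := exists_rep ⟨Γ, hΓ, fun α => hΓ.mp (.dT ∅ α)⟩
    exact ⟨i, fun h => hφΓ ((hi φ hφΦ).1 h)⟩

end Filtration

/-! ### Trees of histories -/

section Tree

open scoped symmDiff NNReal

variable {α : Type*} {h h' h'' a g : List α} {s : α}

theorem suffix_of_suffix_of_not_suffix {b k : List α} (hb : b <:+ k) (hs : s :: g <:+ k)
    (hbg : ¬ b <:+ g) : s :: g <:+ b := by
  rcases List.suffix_or_suffix_of_suffix hb hs with h | h
  · rcases List.suffix_cons_iff.1 h with rfl | h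
    · exact List.suffix_rfl
    · exact absurd h hbg
  · exact h

theorem not_cons_suffix_of_suffix (h : g <:+ a) : ¬ s :: a <:+ g := fun h' => by
  have := (h'.trans h).length_le
  simp at this

section Relations

variable {R : List α → List α → Prop} (hrefl : ∀ h, R h h)
  (htrans : ∀ {h h' h''}, R h h' → R h' h'' → R h h'')
include hrefl htrans

theorem rel_of_suffix (hg : g <:+ h)
    (hup : ∀ s k, s :: k <:+ h → ¬ s :: k <:+ g → R (s :: k) k) : R h g := by
  induction h with
  | nil => exact List.suffix_nil.1 hg ▸ hrefl _
  | cons s k ih =>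
    rcases List.suffix_cons_iff.1 hg with rfl | hg
    · exact hrefl _
    · exact htrans (hup s k List.suffix_rfl (not_cons_suffix_of_suffix hg))
        (ih hg fun t l ht => hup t l (ht.trans (List.suffix_cons s k)))

theorem rel_of_edges (hup : ∀ s k, s :: k <:+ h → ¬ s :: k <:+ h' → R (s :: k) k)
    (hdown : ∀ s k, s :: k <:+ h' → ¬ s :: k <:+ h → R k (s :: k)) : R h h' := by
  by_cases hs : h' <:+ h
  · exact rel_of_suffix hrefl htrans hs hup
  induction h' with
  | nil => exact absurd List.nil_suffix hs
  | cons s g ih =>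
    have hup' : ∀ t k, t :: k <:+ h → ¬ t :: k <:+ g → R (t :: k) k := fun t k hk hkg =>
      hup t k hk fun hks => (List.suffix_cons_iff.1 hks).elim (fun e => hs (e ▸ hk)) hkg
    refine htrans ?_ (hdown s g List.suffix_rfl hs)
    by_cases hg : g <:+ h
    · exact rel_of_suffix hrefl htrans hg hup'
    · exact ih hup' (fun t k hk => hdown t k (hk.trans (List.suffix_cons s g))) hg

end Relations

open scoped Classical in
/-- The path between two lists in the tree of lists under extension, as a set of edges. The edge
between `h` and `s :: h` is represented by `s :: h`. -/
noncomputable def treePath (h h' : List α) : Finset (List α) :=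
  h.tails.toFinset ∆ h'.tails.toFinset

theorem mem_treePath : a ∈ treePath h h' ↔ (a <:+ h ∧ ¬ a <:+ h') ∨ (a <:+ h' ∧ ¬ a <:+ h) := by
  classical
  simp [treePath, Finset.mem_symmDiff]

theorem treePath_self : treePath h h = ∅ := by
  classical exact symmDiff_self h.tails.toFinset

theorem treePath_comm : treePath h h' = treePath h' h := by
  classical exact symmDiff_comm h.tails.toFinset h'.tails.toFinset

theorem treePath_cons : treePath h (s :: h) = {s :: h} := by
  ext a
  have hs : s :: h ≠ [] ∧ ¬ s :: h <:+ h := ⟨List.cons_ne_nil _ _,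
    not_cons_suffix_of_suffix List.suffix_rfl⟩
  rw [mem_treePath, List.suffix_cons_iff, Finset.mem_singleton]
  constructor
  · tauto
  · rintro rfl
    exact .inr ⟨.inl rfl, hs.2⟩

theorem exists_eq_cons_of_mem_treePath (ha : a ∈ treePath h h') : ∃ s g, a = s :: g := by
  refine List.exists_cons_of_ne_nil ?_
  rintro rfl
  simp [mem_treePath] at ha

theorem treePath_subset_of_mem (ha : s :: g ∈ treePath h h') : treePath h g ⊆ treePath h h' := by
  have suffix_cons : g <:+ s :: g := List.suffix_cons s g
  intro b hb
  rw [mem_treePath] at *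
  rcases ha with ⟨hs, hs'⟩ | ⟨hs', hs⟩ <;> rcases hb with ⟨hb, hbg⟩ | ⟨hbg, hb⟩
  · exact .inl ⟨hb, fun hb' => hs' ((suffix_of_suffix_of_not_suffix hb hs hbg).trans hb')⟩
  · exact absurd (hbg.trans (suffix_cons.trans hs)) hb
  · exact .inl ⟨hb, fun hb' => hs ((suffix_of_suffix_of_not_suffix hb' hs' hbg).trans hb)⟩
  · exact .inr ⟨hbg.trans (suffix_cons.trans hs'), hb⟩

/-- The ultrametric given by the maximal length of an edge on the path between two lists. -/
noncomputable def treeDist (len : List α → ℝ≥0) (h h' : List α) : ℝ≥0 :=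
  (treePath h h').sup len

variable {len : List α → ℝ≥0}

theorem treeDist_self : treeDist len h h = 0 := by
  rw [treeDist, treePath_self, Finset.sup_empty, bot_eq_zero]

theorem treeDist_comm : treeDist len h h' = treeDist len h' h := by
  rw [treeDist, treePath_comm, treeDist]

theorem treeDist_triangle : treeDist len h h'' ≤ max (treeDist len h h') (treeDist len h' h'') := by
  classical
  exact (Finset.sup_mono (symmDiff_triangle _ _ _)).trans_eq Finset.sup_union

theorem treeDist_cons : treeDist len h (s :: h) = len (s :: h) := by
  rw [treeDist, treePath_cons, Finset.sup_singleton]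

theorem le_treeDist (ha : a ∈ treePath h h') : len a ≤ treeDist len h h' := Finset.le_sup ha

theorem treeDist_le_of_mem (ha : s :: g ∈ treePath h h') : treeDist len h g ≤ treeDist len h h' :=
  Finset.sup_mono (treePath_subset_of_mem ha)

/-- Lists as a pseudometric space, with the distance `treeDist len`. -/
noncomputable abbrev treePseudoMetric (len : List α → ℝ≥0) : PseudoMetricSpace (List α) where
  dist h h' := treeDist len h h'
  dist_self _ := by rw [treeDist_self, NNReal.coe_zero]
  dist_comm _ _ := by rw [treeDist_comm]
  dist_triangle _ _ _ := by
    rw [← NNReal.coe_add, NNReal.coe_le_coe]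
    exact treeDist_triangle.trans (max_le_add_of_nonneg zero_le zero_le)

end Tree

/-- A step of a history: the index of a set of variables whose values stay equal (`none`) or
`1 / (e + 2)`-close (`some e`), and the world the step leads to. -/
abbrev Step (B W : Type*) := B × Option ℕ × W

/-- The last world of a history that starts at `a₀`. -/
def lastWorld {B W : Type*} (a₀ : W) : List (Step B W) → W
  | [] => a₀
  | (_, _, b) :: _ => b

section OneDiv

open scoped NNReal

theorem one_div_add_two_pos (e : ℕ) : 0 < 1 / ((e : ℝ≥0) + 2) := by positivity

theorem one_div_add_two_lt_one (e : ℕ) : 1 / ((e : ℝ≥0) + 2) < 1 := by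
  rw [div_lt_one (by positivity)]
  exact one_lt_two.trans_le le_add_self

theorem exists_one_div_add_two_lt {r : ℝ≥0} (hr : 0 < r) : ∃ e : ℕ, 1 / ((e : ℝ≥0) + 2) < r := by
  obtain ⟨e, he⟩ := exists_nat_one_div_lt hr
  refine ⟨e, lt_of_le_of_lt ?_ he⟩
  gcongr
  exact one_le_two

end OneDiv

namespace RelFrame

open scoped NNReal

variable {B V W : Type*} (F : RelFrame B V W) (a₀ : W)

/-- A history is a list of steps, the most recent one first, each of which follows the relation of
its kind. -/
def IsHistory : List (Step B W) → Prop
  | [] => True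
  | (β, none, b) :: h => F.eqv β (lastWorld a₀ h) b ∧ IsHistory h
  | (β, some _, b) :: h => F.le β (lastWorld a₀ h) b ∧ IsHistory h

open scoped Classical in
/-- The length, as seen by the variable `x`, of the edge that adds the first entry of a history. -/
noncomputable def edgeLen (x : V) : List (Step B W) → ℝ≥0
  | [] => 0
  | (β, none, _) :: h => if F.dD (lastWorld a₀ h) β x then 0 else 1
  | (β, some e, _) :: h =>
      if F.dD (lastWorld a₀ h) F.empty x then 0
      else if F.dK (lastWorld a₀ h) β x then 1 / ((e : ℝ≥0) + 2) else 1

/-- A radius so small that edges above `h` that are shorter have length zero. -/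
def IsRadius (r : ℝ≥0) (h : List (Step B W)) : Prop :=
  0 < r ∧ r ≤ 1 ∧ ∀ a, a <:+ h → ∀ x, F.edgeLen a₀ x a < r → F.edgeLen a₀ x a = 0

variable {F a₀} {x y : V} {β γ : B} {e : ℕ} {a b : W} {s : Step B W} {h h' : List (Step B W)}
  {r ε : ℝ≥0}

theorem IsHistory.tail (hh : F.IsHistory a₀ (s :: h)) : F.IsHistory a₀ h := by
  obtain ⟨β, _ | e, b⟩ := s <;> exact hh.2

theorem IsHistory.of_suffix {g : List (Step B W)} (hh : F.IsHistory a₀ h) (hg : g <:+ h) :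
    F.IsHistory a₀ g := by
  obtain ⟨p, rfl⟩ := hg
  induction p with
  | nil => exact hh
  | cons s p ih => exact ih hh.tail

theorem IsHistory.of_mem_treePath {g : List (Step B W)} (hh : F.IsHistory a₀ h)
    (hh' : F.IsHistory a₀ h') (hg : g ∈ treePath h h') : F.IsHistory a₀ g :=
  (mem_treePath.1 hg).elim (fun hg => hh.of_suffix hg.1) (fun hg => hh'.of_suffix hg.1)

theorem edgeLen_none_eq_zero_iff :
    F.edgeLen a₀ x ((β, none, b) :: h) = 0 ↔ F.dD (lastWorld a₀ h) β x := by
  simp [edgeLen]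

theorem edgeLen_none_lt_one_iff :
    F.edgeLen a₀ x ((β, none, b) :: h) < 1 ↔ F.dD (lastWorld a₀ h) β x := by
  by_cases hd : F.dD (lastWorld a₀ h) β x <;> simp [edgeLen, hd]

theorem edgeLen_some_eq_zero_iff :
    F.edgeLen a₀ x ((β, some e, b) :: h) = 0 ↔ F.dD (lastWorld a₀ h) F.empty x := by
  simp only [edgeLen]
  split_ifs with hd hk <;> simp [hd]

theorem edgeLen_some_le (hk : F.dK (lastWorld a₀ h) β x) :
    F.edgeLen a₀ x ((β, some e, b) :: h) ≤ 1 / ((e : ℝ≥0) + 2) := by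
  simp only [edgeLen, hk, if_true]
  split_ifs
  exacts [zero_le, le_rfl]

theorem le_edgeLen_some (hd : ¬ F.dD (lastWorld a₀ h) F.empty x) :
    1 / ((e : ℝ≥0) + 2) ≤ F.edgeLen a₀ x ((β, some e, b) :: h) := by
  simp only [edgeLen, hd, if_false]
  split_ifs
  exacts [le_rfl, (one_div_add_two_lt_one e).le]

variable (F a₀) in
theorem exists_isRadius (h : List (Step B W)) : ∃ r, F.IsRadius a₀ r h := by
  have exists_lt_cons (s h) : ∃ r > 0, ∀ x,
      F.edgeLen a₀ x (s :: h) < r → F.edgeLen a₀ x (s :: h) = 0 := by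
    obtain ⟨β, _ | e, b⟩ := s
    · exact ⟨1, one_pos, fun x hx => edgeLen_none_eq_zero_iff.2 (edgeLen_none_lt_one_iff.1 hx)⟩
    · exact ⟨_, one_div_add_two_pos e, fun x hx => edgeLen_some_eq_zero_iff.2
        (by_contra fun hd => hx.not_ge (le_edgeLen_some hd))⟩
  induction h with
  | nil => exact ⟨1, one_pos, le_rfl, fun a ha x _ => by rw [List.suffix_nil.1 ha, edgeLen]⟩
  | cons s h ih =>
    obtain ⟨r, hr, hr₁, hrh⟩ := ih
    obtain ⟨ρ, hρ, hρs⟩ := exists_lt_cons s h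
    refine ⟨min r ρ, lt_min hr hρ, (min_le_left _ _).trans hr₁, fun a ha x hx => ?_⟩
    rcases List.suffix_cons_iff.1 ha with rfl | ha
    · exact hρs x (hx.trans_le (min_le_right _ _))
    · exact hrh a ha x (hx.trans_le (min_le_left _ _))

namespace IsLawful

variable (hF : F.IsLawful)
include hF

theorem dD_of_dD_empty (hd : F.dD a F.empty x) : F.dD a β x :=
  hF.dD_trans _ _ _ _ (fun y hy => absurd hy (hF.not_mem_empty y)) hd

theorem dK_of_dD_empty (hd : F.dD a F.empty x) : F.dK a β x :=
  hF.dK_trans _ _ _ _ (fun y hy => absurd hy (hF.not_mem_empty y)) (hF.dK_empty _ _ hd)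

theorem dK_of_edgeLen_some_lt_one (hlt : F.edgeLen a₀ x ((β, some e, b) :: h) < 1) :
    F.dK (lastWorld a₀ h) β x := by
  by_contra hk
  have hd : ¬ F.dD (lastWorld a₀ h) F.empty x := fun hd => hk (hF.dK_of_dD_empty hd)
  simp [edgeLen, hd, hk] at hlt

theorem eqv_of_edgeLen_eq_zero (hh : F.IsHistory a₀ (s :: h))
    (hz : ∀ x, F.mem x β → F.edgeLen a₀ x (s :: h) = 0) :
    F.eqv β (lastWorld a₀ h) (lastWorld a₀ (s :: h)) := by
  obtain ⟨γ, _ | e, b⟩ := s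
  · exact hF.eqv_of_dD γ _ _ _ (fun x hx => edgeLen_none_eq_zero_iff.1 (hz x hx)) hh.1
  · exact hF.eqv_of_dD F.empty _ _ _ (fun x hx => edgeLen_some_eq_zero_iff.1 (hz x hx))
      (hF.eqv_empty _ _)

theorem le_of_edgeLen_lt_one (hh : F.IsHistory a₀ (s :: h))
    (hlt : ∀ x, F.mem x β → F.edgeLen a₀ x (s :: h) < 1) :
    F.le β (lastWorld a₀ h) (lastWorld a₀ (s :: h)) := by
  obtain ⟨γ, _ | e, b⟩ := s
  · exact hF.le_of_eqv _ _ _ (hF.eqv_of_dD γ _ _ _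
      (fun x hx => edgeLen_none_lt_one_iff.1 (hlt x hx)) hh.1)
  · exact hF.le_of_dK γ _ _ _ (fun x hx => hF.dK_of_edgeLen_some_lt_one (hlt x hx)) hh.1

theorem edgeLen_eq_zero_of_dD (hz : ∀ x, F.mem x β → F.edgeLen a₀ x (s :: h) = 0)
    (hd : F.dD (lastWorld a₀ h) β y) : F.edgeLen a₀ y (s :: h) = 0 := by
  obtain ⟨γ, _ | e, b⟩ := s
  · exact edgeLen_none_eq_zero_iff.2 (hF.dD_trans _ _ _ _
      (fun x hx => edgeLen_none_eq_zero_iff.1 (hz x hx)) hd)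
  · exact edgeLen_some_eq_zero_iff.2 (hF.dD_trans _ _ _ _
      (fun x hx => edgeLen_some_eq_zero_iff.1 (hz x hx)) hd)

theorem edgeLen_lt_of_dK (hε : 0 < ε) (hε₁ : ε ≤ 1)
    (hlt : ∀ x, F.mem x β → F.edgeLen a₀ x (s :: h) < ε) (hk : F.dK (lastWorld a₀ h) β y) :
    F.edgeLen a₀ y (s :: h) < ε := by
  have hlt₁ x (hx : F.mem x β) := (hlt x hx).trans_le hε₁
  obtain ⟨γ, _ | e, b⟩ := s
  · rwa [edgeLen_none_eq_zero_iff.2 (hF.dD_trans _ _ _ _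
      (fun x hx => edgeLen_none_lt_one_iff.1 (hlt₁ x hx)) (hF.dD_of_dK _ _ _ hk))]
  · by_cases hc : ∀ x, F.mem x β → F.dD (lastWorld a₀ h) F.empty x
    · rwa [edgeLen_some_eq_zero_iff.2 (hF.dD_of_dK _ _ _
        (hF.dK_trans _ _ _ _ (fun x hx => hF.dK_empty _ _ (hc x hx)) hk))]
    · push Not at hc
      obtain ⟨x, hx, hxc⟩ := hc
      refine ((edgeLen_some_le ?_).trans (le_edgeLen_some hxc)).trans_lt (hlt x hx)
      exact hF.dK_trans _ _ _ _ (fun x hx => hF.dK_of_edgeLen_some_lt_one (hlt₁ x hx)) hk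

theorem treeDist_le_treeDist_of_lt_one (hx : ∀ a, ¬ F.dD a F.empty x)
    (hy : treeDist (F.edgeLen a₀ y) h h' < 1) :
    treeDist (F.edgeLen a₀ y) h h' ≤ treeDist (F.edgeLen a₀ x) h h' := by
  refine Finset.sup_mono_fun fun a ha => ?_
  have hya : F.edgeLen a₀ y a < 1 := (le_treeDist ha).trans_lt hy
  obtain ⟨⟨β, _ | e, b⟩, g, rfl⟩ := exists_eq_cons_of_mem_treePath ha
  · rw [edgeLen_none_eq_zero_iff.2 (edgeLen_none_lt_one_iff.1 hya)]
    exact zero_le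
  · exact (edgeLen_some_le (hF.dK_of_edgeLen_some_lt_one hya)).trans (le_edgeLen_some (hx _))

theorem treeDist_eq_zero_of_dD_empty (hd : F.dD a F.empty x) :
    treeDist (F.edgeLen a₀ x) h h' = 0 := by
  have dD_empty (b) : F.dD b F.empty x := hF.dD_of_eqv _ _ _ _ (hF.eqv_empty a b) hd
  refine le_antisymm (Finset.sup_le fun c hc => ?_) zero_le
  obtain ⟨⟨β, _ | e, b⟩, g, rfl⟩ := exists_eq_cons_of_mem_treePath hc
  · exact (edgeLen_none_eq_zero_iff.2 (hF.dD_of_dD_empty (dD_empty _))).le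
  · exact (edgeLen_some_eq_zero_iff.2 (dD_empty _)).le

variable (hh : F.IsHistory a₀ h) (hh' : F.IsHistory a₀ h')
include hh hh'

theorem eqv_of_treeDist_eq_zero (hz : ∀ x, F.mem x β → treeDist (F.edgeLen a₀ x) h h' = 0) :
    F.eqv β (lastWorld a₀ h) (lastWorld a₀ h') := by
  have edge (g) (hg : g ∈ treePath h h') (x) (hx : F.mem x β) : F.edgeLen a₀ x g = 0 :=
    le_antisymm ((le_treeDist hg).trans (hz x hx).le) zero_le
  exact rel_of_edges (R := fun h h' => F.eqv β (lastWorld a₀ h) (lastWorld a₀ h'))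
    (fun _ => hF.eqv_refl _ _) (hF.eqv_trans _ _ _ _)
    (fun s g hs hs' => hF.eqv_symm _ _ _ (hF.eqv_of_edgeLen_eq_zero (hh.of_suffix hs)
      (edge _ (mem_treePath.2 (.inl ⟨hs, hs'⟩)))))
    (fun s g hs hs' => hF.eqv_of_edgeLen_eq_zero (hh'.of_suffix hs)
      (edge _ (mem_treePath.2 (.inr ⟨hs, hs'⟩))))

theorem treeDist_eq_zero_of_dD (hz : ∀ x, F.mem x β → treeDist (F.edgeLen a₀ x) h h' = 0)
    (hd : F.dD (lastWorld a₀ h) β y) : treeDist (F.edgeLen a₀ y) h h' = 0 := by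
  refine le_antisymm (Finset.sup_le fun a ha => ?_) zero_le
  obtain ⟨s, g, rfl⟩ := exists_eq_cons_of_mem_treePath ha
  have hg : F.IsHistory a₀ g := (hh.of_mem_treePath hh' ha).tail
  have heqv : F.eqv β (lastWorld a₀ h) (lastWorld a₀ g) :=
    hF.eqv_of_treeDist_eq_zero hh hg fun x hx =>
      le_antisymm ((treeDist_le_of_mem ha).trans (hz x hx).le) zero_le
  exact (hF.edgeLen_eq_zero_of_dD (fun x hx =>
    le_antisymm ((le_treeDist ha).trans (hz x hx).le) zero_le) (hF.dD_of_eqv _ _ _ _ heqv hd)).le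

theorem le_of_treeDist_lt (hr : F.IsRadius a₀ r h)
    (hlt : ∀ x, F.mem x β → treeDist (F.edgeLen a₀ x) h h' < r) :
    F.le β (lastWorld a₀ h) (lastWorld a₀ h') := by
  have edge (g) (hg : g ∈ treePath h h') (x) (hx : F.mem x β) : F.edgeLen a₀ x g < r :=
    (le_treeDist hg).trans_lt (hlt x hx)
  refine rel_of_edges (R := fun h h' => F.le β (lastWorld a₀ h) (lastWorld a₀ h'))
    (fun _ => hF.le_of_eqv _ _ _ (hF.eqv_refl _ _)) (hF.le_trans _ _ _ _)
    (fun s g hs hs' => ?_) (fun s g hs hs' => ?_)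
  · exact hF.le_of_eqv _ _ _ (hF.eqv_symm _ _ _ (hF.eqv_of_edgeLen_eq_zero (hh.of_suffix hs)
      fun x hx => hr.2.2 _ hs x (edge _ (mem_treePath.2 (.inl ⟨hs, hs'⟩)) x hx)))
  · exact hF.le_of_edgeLen_lt_one (hh'.of_suffix hs)
      fun x hx => (edge _ (mem_treePath.2 (.inr ⟨hs, hs'⟩)) x hx).trans_le hr.2.1

theorem treeDist_lt_of_dK (hr : F.IsRadius a₀ r h) (hε : 0 < ε) (hεr : ε ≤ r)
    (hlt : ∀ x, F.mem x β → treeDist (F.edgeLen a₀ x) h h' < ε)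
    (hk : F.dK (lastWorld a₀ h) β y) : treeDist (F.edgeLen a₀ y) h h' < ε := by
  refine (Finset.sup_lt_iff hε).2 fun a ha => ?_
  obtain ⟨s, g, rfl⟩ := exists_eq_cons_of_mem_treePath ha
  have hg : F.IsHistory a₀ g := (hh.of_mem_treePath hh' ha).tail
  have hle : F.le β (lastWorld a₀ h) (lastWorld a₀ g) := hF.le_of_treeDist_lt hh hg hr
    fun x hx => (treeDist_le_of_mem ha).trans_lt ((hlt x hx).trans_le hεr)
  exact hF.edgeLen_lt_of_dK hε (hεr.trans hr.2.1) (fun x hx => (le_treeDist ha).trans_lt (hlt x hx))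
    (hF.dK_of_le _ _ _ _ hle hk)

end IsLawful

end RelFrame

/-! ### Metric models from pseudometrics -/

section RangeMetric

variable {T α : Type*} [PseudoMetricSpace T] {f : T → α}

/-- The metric on the range of a map `f` that identifies exactly the points at distance zero. -/
noncomputable abbrev rangeMetric (hf : ∀ h h', f h = f h' ↔ dist h h' = 0) :
    MetricSpace (Set.range f) where
  toPseudoMetricSpace := .induced (fun p => p.2.choose) inferInstance
  eq_of_dist_eq_zero {p q} h :=
    Subtype.ext (p.2.choose_spec.symm.trans (((hf _ _).2 h).trans q.2.choose_spec))

theorem dist_rangeMetric (hf : ∀ h h', f h = f h' ↔ dist h h' = 0) (h h' : T) :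
    (rangeMetric hf).dist ⟨f h, h, rfl⟩ ⟨f h', h', rfl⟩ = dist h h' := by
  have dist_choose (h : T) : dist (Set.mem_range_self (f := f) h).choose h = 0 :=
    (hf _ _).1 (Set.mem_range_self (f := f) h).choose_spec
  refine (PseudoMetricSpace.dist_eq_of_dist_zero _ (dist_choose h')).trans ?_
  rw [dist_comm, PseudoMetricSpace.dist_eq_of_dist_zero _ (dist_choose h), dist_comm]

end RangeMetric

namespace MetricDepModel

section Nhds

variable {Var : Type u} {Pred : Type v} {ar : Pred → ℕ}
  {M : MetricDepModel.{u, v, w, w'} Var Pred ar} {X : Finset Var} {s : M.toTopoDepModel.State}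

theorem hasBasis_nhdsAt : (M.toTopoDepModel.nhdsAt X s).HasBasis (fun r : ℝ => 0 < r)
    (fun r => {t | ∀ x ∈ X, dist (α := M.D x) (M.val x t) (M.val x s) < r}) := by
  have ball_basis : (𝓝 (M.toTopoDepModel.joint X s)).HasBasis (fun r : ℝ => 0 < r)
      (Metric.ball (α := ∀ x : X, M.D x) (M.toTopoDepModel.joint X s)) :=
    Metric.nhds_basis_ball (α := ∀ x : X, M.D x)
  have mem_ball_iff {r : ℝ} (hr : 0 < r) (t : M.State) :
      dist (α := ∀ x : X, M.D x) (M.toTopoDepModel.joint X t) (M.toTopoDepModel.joint X s) < r ↔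
        ∀ x ∈ X, dist (α := M.D x) (M.val x t) (M.val x s) < r :=
    (dist_pi_lt_iff (X := fun x : X => M.D x) hr).trans Subtype.forall
  rw [TopoDepModel.nhdsAt_eq_comap]
  exact (ball_basis.comap _).to_hasBasis
    (fun r hr => ⟨r, hr, fun t => (mem_ball_iff hr t).2⟩)
    (fun r hr => ⟨r, hr, fun t => (mem_ball_iff hr t).1⟩)

theorem eventually_nhdsAt_iff {p : M.State → Prop} :
    (∀ᶠ t in M.toTopoDepModel.nhdsAt X s, p t) ↔
      ∃ r > 0, ∀ t, (∀ x ∈ X, dist (α := M.D x) (M.val x t) (M.val x s) < r) → p t :=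
  hasBasis_nhdsAt.eventually_iff

end Nhds

section OfPseudoMetric

variable {Var : Type u} {Pred : Type v} {ar : Pred → ℕ} {T : Type}

/-- The value at `h` of a variable with pseudometric `d`: the set of points at distance zero,
together with a number that keeps apart the values of different variables. -/
def taggedClass (d : PseudoMetricSpace T) (n : ℕ) (h : T) : ULift.{w} (ℕ × Set T) :=
  ⟨n, {h' | d.dist h h' = 0}⟩

theorem taggedClass_eq_iff {d : PseudoMetricSpace T} {n : ℕ} (h h' : T) :
    taggedClass.{w} d n h = taggedClass d n h' ↔ d.dist h h' = 0 := by
  simp only [taggedClass, ULift.up_inj, Prod.mk.injEq, true_and]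
  refine ⟨fun heq => ?_, fun hz => Set.ext fun g => ?_⟩
  · have : h' ∈ {g | dist h g = 0} := heq ▸ dist_self h'
    exact this
  · rw [Set.mem_ofPred_eq, Set.mem_ofPred_eq, dist_comm, dist_comm h',
      PseudoMetricSpace.dist_eq_of_dist_zero g hz]

/-- The metric dependence model whose states are the points of a set with a pseudometric for each
variable, a variable taking the same value at points at distance zero. -/
noncomputable def ofPseudoMetric (d : Var → PseudoMetricSpace T) (tag : Var → ℕ)
    (I : ∀ P : Pred, Set (Fin (ar P) → ULift.{w} (ℕ × Set T))) :
    MetricDepModel.{u, v, w, w'} Var Pred ar where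
  Value := ULift.{w} (ℕ × Set T)
  D x := Set.range (taggedClass (d x) (tag x))
  metric x := @rangeMetric _ _ (d x) _ taggedClass_eq_iff
  I P := {f | (fun i => (f i : ULift.{w} (ℕ × Set T))) ∈ I P}
  State := ULift.{w'} T
  val x s := ⟨taggedClass (d x) (tag x) s.down, s.down, rfl⟩
  surj := by
    rintro x ⟨_, h, rfl⟩
    exact ⟨⟨h⟩, rfl⟩

variable {d : Var → PseudoMetricSpace T} {tag : Var → ℕ}
  {I : ∀ P : Pred, Set (Fin (ar P) → ULift.{w} (ℕ × Set T))} {x : Var} {h h' : T}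

theorem dist_val_ofPseudoMetric :
    dist (α := (ofPseudoMetric.{u, v, w, w'} d tag I).D x)
      ((ofPseudoMetric d tag I).val x ⟨h⟩) ((ofPseudoMetric d tag I).val x ⟨h'⟩) =
        (d x).dist h h' :=
  @dist_rangeMetric _ _ (d x) _ taggedClass_eq_iff h h'

theorem sat_atom_ofPseudoMetric {P : Pred} {xs : Fin (ar P) → Var} :
    (ofPseudoMetric.{u, v, w, w'} d tag I).toTopoDepModel.Sat ⟨h⟩ (.atom P xs) ↔
      (fun i => taggedClass (d (xs i)) (tag (xs i)) h) ∈ I P :=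
  Iff.rfl

end OfPseudoMetric

end MetricDepModel

/-! ### The tree of histories as a metric model -/

namespace RelFrame

variable {Var : Type u} {Pred : Type v} {ar : Pred → ℕ} {B W : Type}

/-- The points of the tree unravelling of a frame from `a₀`. -/
abbrev History (F : RelFrame B Var W) (a₀ : W) := {h : List (Step B W) // F.IsHistory a₀ h}

/-- The histories with the pseudometric that the variable `x` puts on the tree. -/
noncomputable abbrev historyPseudoMetric (F : RelFrame B Var W) (a₀ : W) (x : Var) :
    PseudoMetricSpace (F.History a₀) :=
  .induced Subtype.val (treePseudoMetric (F.edgeLen a₀ x))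

open MetricDepModel in
/-- The tree of histories as a metric dependence model. An atom in `S` is true of a tuple of values
if its variables take these values at a history leading to a world where it holds. -/
noncomputable def historyModel (F : RelFrame B Var W) (tr : W → Formula Var Pred ar → Prop)
    (S : Set (Formula Var Pred ar)) (tag : Var → ℕ) (a₀ : W) :
    MetricDepModel.{u, v, w, w'} Var Pred ar :=
  ofPseudoMetric (F.historyPseudoMetric a₀) tag fun P =>
    {f | ∃ xs, atom P xs ∈ S ∧ ∃ h : F.History a₀, tr (lastWorld a₀ h.1) (atom P xs) ∧
      ∀ i, taggedClass (F.historyPseudoMetric a₀ (xs i)) (tag (xs i)) h = f i}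

section HistoryModel

variable {F : RelFrame B Var W} {tr : W → Formula Var Pred ar → Prop}
  {S : Set (Formula Var Pred ar)} {tag : Var → ℕ} {a₀ : W}

/-- The history that is a given state of the history model. -/
def history (s : (historyModel.{u, v, w, w'} F tr S tag a₀).toTopoDepModel.State) :
    F.History a₀ := ULift.down s

/-- The last world of the history that is a given state of the history model. -/
def world (s : (historyModel.{u, v, w, w'} F tr S tag a₀).toTopoDepModel.State) : W :=
  lastWorld a₀ (history s).1

variable {s t : (historyModel.{u, v, w, w'} F tr S tag a₀).toTopoDepModel.State}
  {X Y : Finset Var} {β : B} {x y : Var} {b : W}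

theorem dist_val_historyModel :
    dist (α := (historyModel.{u, v, w, w'} F tr S tag a₀).D x)
      ((historyModel F tr S tag a₀).val x s) ((historyModel F tr S tag a₀).val x t) =
        treeDist (F.edgeLen a₀ x) (history s).1 (history t).1 :=
  MetricDepModel.dist_val_ofPseudoMetric

theorem val_historyModel_eq_iff :
    (historyModel.{u, v, w, w'} F tr S tag a₀).toTopoDepModel.val x s = TopoDepModel.val _ x t ↔
      treeDist (F.edgeLen a₀ x) (history s).1 (history t).1 = 0 := by
  rw [← NNReal.coe_eq_zero, ← dist_val_historyModel]
  exact (@dist_eq_zero _ ((historyModel.{u, v, w, w'} F tr S tag a₀).metric x) _ _).symm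

theorem joint_historyModel_eq_iff :
    TopoDepModel.joint _ X s = TopoDepModel.joint _ X t ↔
      ∀ x ∈ X, treeDist (F.edgeLen a₀ x) (history s).1 (history t).1 = 0 :=
  TopoDepModel.joint_eq_iff.trans <| forall₂_congr fun _ _ => val_historyModel_eq_iff

theorem eventually_nhdsAt_historyModel_iff
    {p : (historyModel.{u, v, w, w'} F tr S tag a₀).toTopoDepModel.State → Prop} :
    (∀ᶠ t in TopoDepModel.nhdsAt _ X s, p t) ↔ ∃ r > 0, ∀ t,
      (∀ x ∈ X, treeDist (F.edgeLen a₀ x) (history s).1 (history t).1 < r) → p t := by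
  refine MetricDepModel.eventually_nhdsAt_iff.trans ?_
  constructor
  · rintro ⟨r, hr, hp⟩
    exact ⟨⟨r, hr.le⟩, hr, fun t ht => hp t fun x hx =>
      ((dist_comm _ _).trans dist_val_historyModel).trans_lt (ht x hx)⟩
  · rintro ⟨r, hr, hp⟩
    exact ⟨r, hr, fun t ht => hp t fun x hx => NNReal.coe_lt_coe.1 <|
      (dist_val_historyModel.symm.trans (dist_comm _ _)).trans_lt (ht x hx)⟩

section Forward

variable (hF : F.IsLawful) (hβ : ∀ x, F.mem x β ↔ x ∈ X)
include hF hβ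

theorem eqv_of_joint_eq (h : TopoDepModel.joint _ X s = TopoDepModel.joint _ X t) :
    F.eqv β (world s) (world t) :=
  hF.eqv_of_treeDist_eq_zero (history s).2 (history t).2 fun x hx =>
    joint_historyModel_eq_iff.1 h x ((hβ x).1 hx)

theorem joint_eq_of_forall_dD (hd : ∀ y ∈ Y, F.dD (world s) β y)
    (h : TopoDepModel.joint _ X s = TopoDepModel.joint _ X t) :
    TopoDepModel.joint _ Y s = TopoDepModel.joint _ Y t :=
  joint_historyModel_eq_iff.2 fun y hy =>
    hF.treeDist_eq_zero_of_dD (history s).2 (history t).2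
      (fun x hx => joint_historyModel_eq_iff.1 h x ((hβ x).1 hx)) (hd y hy)

theorem eventually_nhdsAt_le : ∀ᶠ t in TopoDepModel.nhdsAt _ X s, F.le β (world s) (world t) := by
  obtain ⟨r, hr⟩ := exists_isRadius F a₀ (history s).1
  exact eventually_nhdsAt_historyModel_iff.2 ⟨r, hr.1, fun t ht =>
    hF.le_of_treeDist_lt (history s).2 (history t).2 hr fun x hx => ht x ((hβ x).1 hx)⟩

theorem nhdsAt_le_of_forall_dK (hk : ∀ y ∈ Y, F.dK (world s) β y) :
    TopoDepModel.nhdsAt _ X s ≤ TopoDepModel.nhdsAt _ Y s := by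
  intro U hU
  obtain ⟨ε, hε, hεU⟩ := eventually_nhdsAt_historyModel_iff.1 hU
  obtain ⟨r, hr⟩ := exists_isRadius F a₀ (history s).1
  have hεr : 0 < min ε r := lt_min hε hr.1
  refine eventually_nhdsAt_historyModel_iff.2 ⟨min ε r, hεr, fun t ht => hεU t fun y hy => ?_⟩
  exact (hF.treeDist_lt_of_dK (history s).2 (history t).2 hr hεr (min_le_right _ _)
    (fun x hx => ht x ((hβ x).1 hx)) (hk y hy)).trans_le (min_le_left _ _)

end Forward

section Extend

variable (hF : F.IsLawful) (hβ : ∀ x, F.mem x β ↔ x ∈ X)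

include hF hβ in
theorem exists_joint_eq_of_eqv (h : F.eqv β (world s) b) :
    ∃ t, TopoDepModel.joint _ X s = TopoDepModel.joint _ X t ∧ world t = b ∧
      ∀ Y, TopoDepModel.joint _ Y s = TopoDepModel.joint _ Y t →
        ∀ y ∈ Y, F.dD (world s) β y := by
  let t : (historyModel.{u, v, w, w'} F tr S tag a₀).toTopoDepModel.State :=
    ⟨(β, none, b) :: (history s).1, h, (history s).2⟩
  have treeDist_eq (y : Var) : treeDist (F.edgeLen a₀ y) (history s).1 (history t).1 =
      F.edgeLen a₀ y ((β, none, b) :: (history s).1) := treeDist_cons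
  have joint_eq_iff (Y : Finset Var) : TopoDepModel.joint _ Y s = TopoDepModel.joint _ Y t ↔
      ∀ y ∈ Y, F.dD (world s) β y := by
    simp only [joint_historyModel_eq_iff, treeDist_eq, edgeLen_none_eq_zero_iff, world]
  exact ⟨t, (joint_eq_iff X).2 fun x hx => hF.dD_of_mem _ _ _ ((hβ x).2 hx), rfl,
    fun Y => (joint_eq_iff Y).1⟩

include hF hβ in
theorem frequently_nhdsAt_world_eq (h : F.le β (world s) b) :
    ∃ᶠ t in TopoDepModel.nhdsAt _ X s, world t = b ∧
      ∀ y, treeDist (F.edgeLen a₀ y) (history s).1 (history t).1 < 1 → F.dK (world s) β y := by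
  refine fun hn => ?_
  obtain ⟨r, hr, hrX⟩ := eventually_nhdsAt_historyModel_iff.1 hn
  obtain ⟨e, he⟩ := exists_one_div_add_two_lt hr
  let t : (historyModel.{u, v, w, w'} F tr S tag a₀).toTopoDepModel.State :=
    ⟨(β, some e, b) :: (history s).1, h, (history s).2⟩
  have treeDist_eq (y : Var) : treeDist (F.edgeLen a₀ y) (history s).1 (history t).1 =
      F.edgeLen a₀ y ((β, some e, b) :: (history s).1) := treeDist_cons
  refine hrX t (fun x hx => ?_) ⟨rfl, fun y hy => ?_⟩
  · rw [treeDist_eq]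
    exact (edgeLen_some_le (hF.dK_of_mem _ _ _ ((hβ x).2 hx))).trans_lt he
  · rw [treeDist_eq] at hy
    exact hF.dK_of_edgeLen_some_lt_one hy

end Extend

section Truth

variable (hF : F.IsLawful) (hβ : ∀ x, F.mem x β ↔ x ∈ X)
include hF hβ

theorem forall_joint_eq_iff {p : W → Prop} :
    (∀ t, TopoDepModel.joint _ X s = TopoDepModel.joint _ X t → p (world t)) ↔
      ∀ b, F.eqv β (world s) b → p b := by
  refine ⟨fun h b hb => ?_, fun h t ht => h _ (eqv_of_joint_eq hF hβ ht)⟩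
  obtain ⟨t, ht, rfl, -⟩ := exists_joint_eq_of_eqv hF hβ hb
  exact h t ht

theorem eventually_nhdsAt_world_iff {p : W → Prop} :
    (∀ᶠ t in TopoDepModel.nhdsAt _ X s, p (world t)) ↔ ∀ b, F.le β (world s) b → p b := by
  refine ⟨fun h b hb => ?_, fun h => (eventually_nhdsAt_le hF hβ).mono fun t ht => h _ ht⟩
  obtain ⟨t, ⟨rfl, -⟩, ht⟩ := ((frequently_nhdsAt_world_eq hF hβ hb).and_eventually h).exists
  exact ht

theorem sat_ddep_historyModel_iff : TopoDepModel.Sat _ s (.ddep X Y) ↔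
    ∀ y ∈ Y, F.dD (world s) β y := by
  refine ⟨fun h => ?_, fun h t => joint_eq_of_forall_dD hF hβ h⟩
  obtain ⟨t, ht, -, hd⟩ := exists_joint_eq_of_eqv hF hβ (hF.eqv_refl β (world s))
  exact hd Y (h t ht)

theorem nhdsAt_le_historyModel_iff :
    TopoDepModel.nhdsAt _ X s ≤ TopoDepModel.nhdsAt _ Y s ↔ ∀ y ∈ Y, F.dK (world s) β y := by
  refine ⟨fun h y hy => ?_, nhdsAt_le_of_forall_dK hF hβ⟩
  have eventually_lt_one : ∀ᶠ t in TopoDepModel.nhdsAt _ X s,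
      treeDist (F.edgeLen a₀ y) (history s).1 (history t).1 < 1 :=
    h (eventually_nhdsAt_historyModel_iff.2 ⟨1, one_pos, fun t ht => ht y hy⟩)
  have hle : F.le β (world s) (world s) := hF.le_of_eqv _ _ _ (hF.eqv_refl _ _)
  obtain ⟨t, ⟨-, hdK⟩, ht⟩ :=
    ((frequently_nhdsAt_world_eq hF hβ hle).and_eventually eventually_lt_one).exists
  exact hdK y ht

theorem sat_kdep_historyModel_iff : TopoDepModel.Sat _ s (.kdep X Y) ↔
    ∀ y ∈ Y, F.dK (world s) β y := by
  have dK_le {a b : W} (h : F.le β a b) (hd : ∀ y ∈ Y, F.dK a β y) : ∀ y ∈ Y, F.dK b β y :=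
    fun y hy => hF.dK_of_le _ _ _ _ h (hd y hy)
  rw [TopoDepModel.sat_kdep]
  simp only [nhdsAt_le_historyModel_iff hF hβ]
  exact ⟨TopoDepModel.self_of_eventually_nhdsAt, fun h =>
    (eventually_nhdsAt_le hF hβ).mono fun t ht => dK_le ht h⟩

end Truth

section Premodel

variable [DecidableEq Var]

/-- The extensions of the predicates are unions over the atoms in `S`, which do not interfere with
one another because the tags tell their variables apart. -/
theorem sat_atom_historyModel_iff (hF : F.IsLawful) {P : Pred} {xs : Fin (ar P) → Var}
    (htag : Set.InjOn (tag ∘ ·) {xs : Fin (ar P) → Var | atom P xs ∈ S}) (hxs : atom P xs ∈ S)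
    (hβ : ∀ x, F.mem x β ↔ x ∈ (atom P xs).source) (hc : F.TruthClause tr β (atom P xs)) :
    TopoDepModel.Sat _ s (atom P xs) ↔ tr (world s) (atom P xs) := by
  refine MetricDepModel.sat_atom_ofPseudoMetric.trans
    ⟨?_, fun h => ⟨xs, hxs, history s, h, fun _ => rfl⟩⟩
  rintro ⟨xs', hxs', h, htr, heq⟩
  obtain rfl : xs' = xs := htag hxs' hxs (funext fun i => congrArg (·.down.1) (heq i))
  refine hc _ _ (hF.eqv_of_treeDist_eq_zero h.2 (history s).2 fun x hx => ?_) htr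
  obtain ⟨i, -, rfl⟩ := Finset.mem_image.1 ((hβ x).1 hx)
  exact NNReal.coe_eq_zero.1 ((MetricDepModel.taggedClass_eq_iff _ _).1 (heq i))

theorem sat_historyModel_iff (hp : F.IsPremodel tr S)
    (htag : ∀ P, Set.InjOn (tag ∘ ·) {xs : Fin (ar P) → Var | atom P xs ∈ S})
    {φ : Formula Var Pred ar} (hφ : φ ∈ S) :
    TopoDepModel.Sat _ s φ ↔ tr (world s) φ := by
  have hF := hp.isLawful
  have child_mem {φ ψ : Formula Var Pred ar} (hφ : φ ∈ S) (hψ : ψ ∈ φ.children) : ψ ∈ S :=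
    hp.closed φ hφ hψ
  induction φ generalizing s <;> obtain ⟨β, hβ, hc⟩ := hp.truthClause _ hφ
  case atom P xs => exact sat_atom_historyModel_iff hF (htag P) hφ hβ hc
  case neg φ ih => exact (not_congr (ih (child_mem hφ rfl))).trans (hc _).symm
  case and φ ψ ihφ ihψ =>
    exact (and_congr (ihφ (child_mem hφ (.inl rfl))) (ihψ (child_mem hφ (.inr rfl)))).trans
      (hc _).symm
  case dmod X φ ih =>
    refine (forall₂_congr fun t _ => ih (child_mem hφ rfl)).trans ?_
    exact (forall_joint_eq_iff hF hβ).trans (hc _).symm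
  case kmod X φ ih =>
    refine TopoDepModel.sat_kmod.trans ?_
    refine (eventually_congr (.of_forall fun t => ih (child_mem hφ rfl))).trans ?_
    exact (eventually_nhdsAt_world_iff hF hβ).trans (hc _).symm
  case ddep X Y => exact (sat_ddep_historyModel_iff hF hβ).trans (hc _).symm
  case kdep X Y => exact (sat_kdep_historyModel_iff hF hβ).trans (hc _).symm

end Premodel

theorem isPseudoLocallyLipschitz_historyModel (hF : F.IsLawful) :
    (historyModel.{u, v, w, w'} F tr S tag a₀).IsPseudoLocallyLipschitz := by
  intro x y hx
  have not_dD_empty (a : W) : ¬ F.dD a F.empty x := fun ha =>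
    hx fun s t => (val_historyModel_eq_iff (tr := tr) (S := S)).2
      (hF.treeDist_eq_zero_of_dD_empty ha)
  let _ := (historyModel.{u, v, w, w'} F tr S tag a₀).statePseudoMetric x
  refine fun s => ⟨Set.univ, isOpen_univ, trivial, Metric.ball _ 1, Metric.isOpen_ball,
    Metric.mem_ball_self one_pos, 1, LipschitzOnWith.of_dist_le_mul fun p hp q hq => ?_⟩
  have hp : treeDist (F.edgeLen a₀ y) (history p).1 (history s).1 < 1 :=
    NNReal.coe_lt_coe.1 (dist_val_historyModel.symm.trans_lt hp.2)
  have hq : treeDist (F.edgeLen a₀ y) (history q).1 (history s).1 < 1 :=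
    NNReal.coe_lt_coe.1 (dist_val_historyModel.symm.trans_lt hq.2)
  have hpq : treeDist (F.edgeLen a₀ y) (history p).1 (history q).1 < 1 :=
    treeDist_triangle.trans_lt (max_lt hp (treeDist_comm.trans_lt hq))
  rw [NNReal.coe_one, one_mul]
  refine dist_val_historyModel.trans_le (.trans ?_ dist_val_historyModel.symm.le)
  exact NNReal.coe_le_coe.2 (hF.treeDist_le_treeDist_of_lt_one not_dD_empty hpq)

end HistoryModel

theorem IsPremodel.exists_metricDepModel [DecidableEq Var] {F : RelFrame B Var W}
    {tr : W → Formula Var Pred ar → Prop} {S : Set (Formula Var Pred ar)}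
    (hp : F.IsPremodel tr S) {tag : Var → ℕ}
    (htag : ∀ P, Set.InjOn (tag ∘ ·) {xs : Fin (ar P) → Var | atom P xs ∈ S})
    {φ : Formula Var Pred ar} (hφ : φ ∈ S) {a : W} (ha : ¬ tr a φ) :
    ∃ M : MetricDepModel.{u, v, w, w'} Var Pred ar,
      M.IsPseudoLocallyLipschitz ∧ ¬ M.toTopoDepModel.GloballyTrue φ :=
  ⟨historyModel F tr S tag a, isPseudoLocallyLipschitz_historyModel hp.isLawful, fun h =>
    ha ((sat_historyModel_iff (s := ⟨⟨[], trivial⟩⟩) hp htag hφ).1 (h _))⟩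

end RelFrame

/-! ### Completeness -/

section Completeness

variable {Var : Type u} {Pred : Type v} {ar : Pred → ℕ} [DecidableEq Var]

theorem exists_metricDepModel_of_not_provable {φ : Formula Var Pred ar} (hφ : ¬ Provable φ) :
    ∃ M : MetricDepModel.{u, v, w, w'} Var Pred ar,
      M.IsPseudoLocallyLipschitz ∧ ¬ M.toTopoDepModel.GloballyTrue φ := by
  have source_target_subset {ψ} (hψ : ψ ∈ φ.subformulas) : ψ.source ⊆ φ.vars ∧ ψ.target ⊆ φ.vars :=
    Finset.union_subset_iff.1
      (ψ.source_union_target_subset_vars.trans (vars_subset_of_mem_subformulas hψ))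
  let e := φ.vars.powerset.equivFin
  let ι (β) := (e.symm β).1
  obtain ⟨g, hg, a, ha⟩ := exists_isCanonicalFamily
    (finite_filtrationSet φ.vars ι φ.finite_subformulas) le_rfl (.inl φ.mem_subformulas_self) hφ
  have hp := isPremodel_canonicalFrame (empty := e ⟨∅, Finset.empty_mem_powerset _⟩) hg
    (fun β => Finset.mem_powerset.1 (e.symm β).2) (by simp only [ι, e.symm_apply_apply])
    φ.subformulaClosed_subformulas (fun ψ hψ => (source_target_subset hψ).2)
    (fun ψ hψ => ⟨e ⟨_, Finset.mem_powerset.2 (source_target_subset hψ).1⟩,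
      by simp only [ι, e.symm_apply_apply]⟩)
  obtain ⟨tag, htag⟩ := Set.countable_iff_exists_injOn.1 φ.vars.countable_toSet
  refine hp.exists_metricDepModel (tag := tag) (fun P xs hxs ys hys hxy => funext fun i => ?_)
    φ.mem_subformulas_self ha
  have mem_vars {xs : Fin (ar P) → Var} (hxs : atom P xs ∈ φ.subformulas) : xs i ∈ φ.vars :=
    (source_target_subset hxs).1 (Finset.mem_image_of_mem xs (Finset.mem_univ i))
  exact htag (mem_vars hxs) (mem_vars hys) (congrFun hxy i)

theorem provable_iff_validPseudoLocallyLipschitz {φ : Formula Var Pred ar} :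
    Provable φ ↔ ValidPseudoLocallyLipschitz.{u, v, w, w'} φ := by
  refine ⟨fun h M _ => TopoDepModel.sat_of_provable h, not_imp_not.1 fun hφ hv => ?_⟩
  obtain ⟨M, hM, hMφ⟩ := exists_metricDepModel_of_not_provable.{u, v, w, w'} hφ
  exact hMφ (hv M hM)

theorem provable_iff_validMetric {φ : Formula Var Pred ar} :
    Provable φ ↔ ValidMetric.{u, v, w, w'} φ :=
  ⟨fun h _ => TopoDepModel.sat_of_provable h,
    fun h => provable_iff_validPseudoLocallyLipschitz.2 fun M _ => h M⟩

theorem provable_iff_validTopo {φ : Formula Var Pred ar} :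
    Provable φ ↔ ValidTopo.{u, v, w, w'} φ :=
  ⟨fun h _ => TopoDepModel.sat_of_provable h,
    fun h => provable_iff_validMetric.2 fun M => h M.toTopoDepModel⟩

theorem provable_iff_validConcrete {φ : Formula Var Pred ar} :
    Provable φ ↔ ValidConcrete.{u, v, w} φ :=
  ⟨fun h _ => TopoDepModel.sat_of_provable h, fun h => provable_iff_validTopo.{u, v, w, 0}.2
    fun M _ => M.sat_assignment.1 (h M.toConcrete _)⟩

end Completeness

/-! ### Premodels coded by natural numbers -/

section Encodable

variable {Var : Type u} [Encodable Var]

theorem mem_ofNat_encode_list {L : List Var} {k : ℕ} :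
    k ∈ Denumerable.ofNat (List ℕ) (Encodable.encode L) ↔ ∃ x ∈ L, Encodable.encode x = k := by
  have encode_map (L : List Var) :
      Encodable.encode (L.map Encodable.encode) = Encodable.encode L := by
    induction L with
    | nil => rfl
    | cons x L ih => rw [List.map_cons, Encodable.encode_list_cons, ih]; rfl
  rw [← encode_map, Denumerable.ofNat_encode, List.mem_map]

theorem mem_ofNat_encode_finset {X : Finset Var} {k : ℕ} :
    k ∈ Denumerable.ofNat (List ℕ) (Encodable.encode X) ↔ ∃ x ∈ X, Encodable.encode x = k := by
  obtain ⟨L, hL, hX⟩ : ∃ L : List Var, Encodable.encode X = Encodable.encode L ∧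
      ∀ x, x ∈ L ↔ x ∈ X := ⟨_, rfl, fun x => by simp⟩
  simp only [hL, mem_ofNat_encode_list, hX]

theorem forall_mem_ofNat_encode_finset {X : Finset Var} {n : ℕ} {p : Fin n → Prop} :
    (∀ k : Fin n, k.1 ∈ Denumerable.ofNat (List ℕ) (Encodable.encode X) → p k) ↔
      ∀ x ∈ X, ∀ k : Fin n, Encodable.encode x = k → p k :=
  ⟨fun h x hx k hk => h k (mem_ofNat_encode_finset.2 ⟨x, hx, hk⟩), fun h k hk =>
    have ⟨x, hx, hxk⟩ := mem_ofNat_encode_finset.1 hk; h x hx k hxk⟩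

theorem lt_of_mem_ofNat_list {k l : ℕ} (h : k ∈ Denumerable.ofNat (List ℕ) l) : k < l := by
  rw [← Denumerable.encode_ofNat (α := List ℕ) l]
  generalize Denumerable.ofNat (List ℕ) l = L at h
  induction L with
  | nil => exact absurd h List.not_mem_nil
  | cons a L ih =>
    rw [Encodable.encode_list_cons, Nat.lt_succ_iff]
    rcases List.mem_cons.1 h with rfl | h
    · exact Nat.left_le_pair _ _
    · exact (ih h).le.trans (Nat.right_le_pair _ _)

theorem forall_encode_eq_of_mem_ofNat_iff {X : Finset Var} {n : ℕ} (hX : Encodable.encode X < n)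
    {p : Var → Prop} : (∀ k : Fin n, k.1 ∈ Denumerable.ofNat (List ℕ) (Encodable.encode X) →
      ∀ x, Encodable.encode x = k.1 → p x) ↔ ∀ x ∈ X, p x :=
  forall_mem_ofNat_encode_finset.trans <| forall₂_congr fun x hx =>
    ⟨fun h => h ⟨_, (lt_of_mem_ofNat_list (mem_ofNat_encode_finset.2 ⟨x, hx, rfl⟩)).trans hX⟩
      rfl x rfl, fun h _ hk _ hy => Encodable.encode_injective (hy.trans hk.symm) ▸ h⟩

end Encodable

namespace Formula

variable {Var : Type u} {Pred : Type v} {ar : Pred → ℕ} [Encodable Var]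

/-- The code of a list of the variables in the source of a formula. -/
def sourceCode : Formula Var Pred ar → ℕ
  | atom _ xs => Encodable.encode (List.ofFn xs)
  | neg _ | and _ _ => 0
  | dmod X _ | kmod X _ | ddep X _ | kdep X _ => Encodable.encode X

theorem mem_ofNat_sourceCode [DecidableEq Var] {φ : Formula Var Pred ar} {k : ℕ} :
    k ∈ Denumerable.ofNat (List ℕ) φ.sourceCode ↔ ∃ x ∈ φ.source, Encodable.encode x = k := by
  cases φ with
  | atom => simp [sourceCode, source, mem_ofNat_encode_list, List.mem_ofFn]
  | neg | and => simp [sourceCode, source]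
  | dmod | kmod | ddep | kdep => exact mem_ofNat_encode_finset

variable [Encodable Pred]

theorem code_injective : Function.Injective (code (Var := Var) (Pred := Pred) (ar := ar)) := by
  intro φ
  induction φ <;> rintro (_ | _ | _ | _ | _ | _ | _) h <;>
    simp only [code, Nat.pair_eq_pair] at h <;> try omega
  case atom.atom P xs P' ys =>
    obtain ⟨-, hP, hxs⟩ := h
    obtain rfl := Encodable.encode_injective hP
    rw [List.ofFn_injective (Encodable.encode_injective hxs)]
  case neg.neg ih _ => rw [ih h.2]
  case and.and ih₁ ih₂ _ _ => rw [ih₁ h.2.1, ih₂ h.2.2]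
  case dmod.dmod ih _ _ => rw [Encodable.encode_injective h.2.1, ih h.2.2]
  case kmod.kmod ih _ _ => rw [Encodable.encode_injective h.2.1, ih h.2.2]
  case ddep.ddep | kdep.kdep =>
    rw [Encodable.encode_injective h.2.1, Encodable.encode_injective h.2.2]

theorem sourceCode_le_code (φ : Formula Var Pred ar) : φ.sourceCode ≤ φ.code := by
  cases φ with
  | atom => exact (Nat.right_le_pair _ _).trans (Nat.right_le_pair _ _)
  | neg | and => exact Nat.zero_le _
  | dmod | kmod | ddep | kdep => exact (Nat.left_le_pair _ _).trans (Nat.right_le_pair _ _)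

theorem code_le_code_of_mem_children {φ ψ : Formula Var Pred ar} (h : ψ ∈ φ.children) :
    ψ.code ≤ φ.code := by
  cases φ with
  | neg => exact h ▸ Nat.right_le_pair _ _
  | dmod | kmod => exact h ▸ (Nat.right_le_pair _ _).trans (Nat.right_le_pair _ _)
  | and =>
    rcases h with rfl | rfl
    · exact (Nat.left_le_pair _ _).trans (Nat.right_le_pair _ _)
    · exact (Nat.right_le_pair _ _).trans (Nat.right_le_pair _ _)
  | atom | ddep | kdep => exact absurd h (Set.notMem_empty _)

theorem encode_lt_code_of_mem_target {φ : Formula Var Pred ar} {x : Var} (hx : x ∈ φ.target) :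
    Encodable.encode x < φ.code := by
  cases φ with
  | ddep | kdep =>
    exact (lt_of_mem_ofNat_list (mem_ofNat_encode_finset.2 ⟨x, hx, rfl⟩)).trans_le
      ((Nat.right_le_pair _ _).trans (Nat.right_le_pair _ _))
  | _ => exact absurd hx (Finset.notMem_empty _)

theorem encode_lt_code_of_mem_source [DecidableEq Var] {φ : Formula Var Pred ar} {x : Var}
    (hx : x ∈ φ.source) : Encodable.encode x < φ.code :=
  (lt_of_mem_ofNat_list (mem_ofNat_sourceCode.2 ⟨x, hx, rfl⟩)).trans_le φ.sourceCode_le_code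

end Formula

/-- The relation with index `k` among those coded by the bits of `m`. -/
def bitRel (m k x y z : ℕ) : Prop :=
  m.testBit (Nat.pair k (Nat.pair x (Nat.pair y z))) = true

/-- A number of worlds that suffices to refute an unprovable formula with code `n`. -/
def stateBound (n : ℕ) : ℕ := 2 ^ ((n + 1) + 2 * ((n + 1) * (n + 1)))

/-- A bound on the positions of the bits coding a premodel that refutes a formula with code `n`. -/
def bitBound (n : ℕ) : ℕ :=
  Nat.pair 6 (Nat.pair (stateBound n + (n + 1))
    (Nat.pair (stateBound n + (n + 1)) (stateBound n + (n + 1))))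

/-- The frame coded by the relations `0` to `3` of `m`. Variables are represented by their codes
and sets of variables by codes of lists of these, all of them at most `n`. -/
def codedFrame (n m : ℕ) : RelFrame (Fin (n + 1)) (Fin (n + 1)) (Fin (stateBound n)) where
  mem y l := y.1 ∈ Denumerable.ofNat (List ℕ) l
  empty := 0
  eqv l i j := bitRel m 0 l i j
  le l i j := bitRel m 1 l i j
  dD i l y := bitRel m 2 i l y
  dK i l y := bitRel m 3 i l y

/-- The formula with code `c` is true at the world `i`, according to the relation `4` of `m`. -/
def CodedTruth (m i c : ℕ) : Prop := bitRel m 4 i c 0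

/-- The number `c` is marked by `m` as the code of a formula, by means of the relation `5`. The
marks are needed since not every number is the code of a formula. -/
def IsMarked (m c : ℕ) : Prop := bitRel m 5 c 0 0

/-- The condition on `m` that the truth values of the formula with code `c`, if there is one,
satisfy the truth condition in `codedFrame n m`. -/
structure CodeClause (n m c : ℕ) : Prop where
  atom : ∀ p l : Fin (n + 1), c = Nat.pair 0 (Nat.pair p l) → ∀ i j : Fin (stateBound n),
    (codedFrame n m).eqv l i j → CodedTruth m i c → CodedTruth m j c
  neg : ∀ d : Fin (n + 1), c = Nat.pair 1 d → IsMarked m d ∧ ∀ i : Fin (stateBound n),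
    CodedTruth m i c ↔ ¬ CodedTruth m i d
  and : ∀ d e : Fin (n + 1), c = Nat.pair 2 (Nat.pair d e) → IsMarked m d ∧ IsMarked m e ∧
    ∀ i : Fin (stateBound n), CodedTruth m i c ↔ CodedTruth m i d ∧ CodedTruth m i e
  dmod : ∀ l d : Fin (n + 1), c = Nat.pair 3 (Nat.pair l d) → IsMarked m d ∧
    ∀ i : Fin (stateBound n),
      CodedTruth m i c ↔ ∀ j : Fin (stateBound n), (codedFrame n m).eqv l i j → CodedTruth m j d
  kmod : ∀ l d : Fin (n + 1), c = Nat.pair 4 (Nat.pair l d) → IsMarked m d ∧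
    ∀ i : Fin (stateBound n),
      CodedTruth m i c ↔ ∀ j : Fin (stateBound n), (codedFrame n m).le l i j → CodedTruth m j d
  ddep : ∀ l k : Fin (n + 1), c = Nat.pair 5 (Nat.pair l k) → ∀ i : Fin (stateBound n),
    CodedTruth m i c ↔
      ∀ y : Fin (n + 1), (codedFrame n m).mem y k → (codedFrame n m).dD i l y
  kdep : ∀ l k : Fin (n + 1), c = Nat.pair 6 (Nat.pair l k) → ∀ i : Fin (stateBound n),
    CodedTruth m i c ↔
      ∀ y : Fin (n + 1), (codedFrame n m).mem y k → (codedFrame n m).dK i l y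

/-- The number `m` codes a premodel that refutes the formula with code `n`. -/
structure CodeRefutes (n m : ℕ) : Prop where
  isLawful : (codedFrame n m).IsLawful
  codeClause : ∀ c < n + 1, IsMarked m c → CodeClause n m c
  isMarked : IsMarked m n
  not_forall_codedTruth : ¬ ∀ i : Fin (stateBound n), CodedTruth m i n

section Primrec

variable {α : Type*} [Primcodable α]

theorem primrecPred_forall_lt {p : α → ℕ → Prop} {f : α → ℕ} (hf : Primrec f)
    (hp : PrimrecPred fun q : α × ℕ => p q.1 q.2) : PrimrecPred fun a => ∀ x < f a, p a x :=
  ((PrimrecRel.forall_mem_list (R := fun x a => p a x)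
    (hp.comp (Primrec.pair Primrec.snd Primrec.fst))).comp
      (Primrec.list_range.comp hf) Primrec.id).of_eq fun _ => by simp

theorem primrecPred_imp {p q : α → Prop} (hp : PrimrecPred p) (hq : PrimrecPred q) :
    PrimrecPred fun a => p a → q a :=
  (hp.not.or hq).of_eq fun _ => imp_iff_not_or.symm

theorem primrecPred_iff {p q : α → Prop} (hp : PrimrecPred p) (hq : PrimrecPred q) :
    PrimrecPred fun a => p a ↔ q a :=
  ((primrecPred_imp hp hq).and (primrecPred_imp hq hp)).of_eq fun _ => iff_def.symm

theorem primrec_two_pow {f : α → ℕ} (hf : Primrec f) : Primrec fun a => 2 ^ f a :=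
  (Primrec₂.unpaired'.1 Nat.Primrec.pow).comp (Primrec.const 2) hf

theorem primrecPred_testBit {f g : α → ℕ} (hf : Primrec f) (hg : Primrec g) :
    PrimrecPred fun a => (f a).testBit (g a) = true :=
  (Primrec.eq.comp (Primrec.nat_mod.comp (Primrec.nat_div.comp hf (primrec_two_pow hg))
    (Primrec.const 2)) (Primrec.const 1)).of_eq fun a => by
      rw [Nat.testBit_eq_decide_div_mod_eq, decide_eq_true_iff]

theorem primrecPred_bitRel {f g₁ g₂ g₃ : α → ℕ} (k : ℕ) (hf : Primrec f) (h₁ : Primrec g₁)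
    (h₂ : Primrec g₂) (h₃ : Primrec g₃) :
    PrimrecPred fun a => bitRel (f a) k (g₁ a) (g₂ a) (g₃ a) :=
  primrecPred_testBit hf (Primrec₂.natPair.comp (Primrec.const k)
    (Primrec₂.natPair.comp h₁ (Primrec₂.natPair.comp h₂ h₃)))

theorem primrecPred_mem_ofNat_list {f g : α → ℕ} (hf : Primrec f) (hg : Primrec g) :
    PrimrecPred fun a => f a ∈ Denumerable.ofNat (List ℕ) (g a) :=
  ((PrimrecRel.exists_mem_list (R := fun x y : ℕ => x = y) Primrec.eq).comp
    ((Primrec.ofNat (List ℕ)).comp hg) hf).of_eq fun a => by simp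

theorem primrec_stateBound {f : α → ℕ} (hf : Primrec f) : Primrec fun a => stateBound (f a) :=
  have hs := Primrec.succ.comp hf
  primrec_two_pow (Primrec.nat_add.comp hs
    (Primrec.nat_mul.comp (Primrec.const 2) (Primrec.nat_mul.comp hs hs)))

theorem primrec_bitBound {f : α → ℕ} (hf : Primrec f) : Primrec fun a => bitBound (f a) :=
  have h := Primrec.nat_add.comp (primrec_stateBound hf) (Primrec.succ.comp hf)
  Primrec₂.natPair.comp (Primrec.const 6) (Primrec₂.natPair.comp h (Primrec₂.natPair.comp h h))

end Primrec

theorem primrecPred_isLawful_codedFrame :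
    PrimrecPred fun q : ℕ × ℕ => (codedFrame q.1 q.2).IsLawful := by
  refine (PrimrecPred.and ?_ <| .and ?_ <| .and ?_ <| .and ?_ <| .and ?_ <| .and ?_ <|
    .and ?_ <| .and ?_ <| .and ?_ <| .and ?_ <| .and ?_ <| .and ?_ <| .and ?_ <| .and ?_ <|
    .and ?_ <| .and ?_ ?_).of_eq fun q =>
    ⟨fun h => by casesm* _ ∧ _; constructor <;> assumption,
      fun h => ⟨h.not_mem_empty, h.eqv_refl, h.eqv_symm, h.eqv_trans, h.eqv_empty, h.le_of_eqv,
        h.le_trans, h.dD_of_mem, h.dD_trans, h.dD_of_eqv, h.eqv_of_dD, h.dK_of_mem, h.dK_trans,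
        h.dK_of_le, h.le_of_dK, h.dD_of_dK, h.dK_empty⟩⟩ <;>
  simp only [codedFrame, Fin.forall_iff, Fin.val_zero] <;>
  repeat' with_reducible first
    | exact Primrec.const _
    | exact Primrec.id
    | exact Primrec.fst
    | exact Primrec.snd
    | apply PrimrecPred.not
    | apply primrecPred_forall_lt
    | apply primrecPred_bitRel
    | apply primrecPred_mem_ofNat_list
    | apply primrecPred_imp
    | apply primrec_stateBound
    | apply Primrec.fst.comp
    | apply Primrec.snd.comp
    | apply Primrec.succ.comp

theorem primrecPred_codeRefutes : PrimrecPred fun q : ℕ × ℕ => CodeRefutes q.1 q.2 := by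
  refine (primrecPred_isLawful_codedFrame.and <|
    .and (primrecPred_forall_lt (p := fun q c => IsMarked q.2 c → CodeClause q.1 q.2 c)
      (Primrec.succ.comp Primrec.fst) <| primrecPred_imp ?_ <|
        (PrimrecPred.and ?_ <| .and ?_ <| .and ?_ <| .and ?_ <| .and ?_ <| .and ?_ ?_).of_eq
          fun q => ⟨fun h => by casesm* _ ∧ _; constructor <;> assumption,
            fun h => ⟨h.atom, h.neg, h.and, h.dmod, h.kmod, h.ddep, h.kdep⟩⟩) <|
    .and ?_ ?_).of_eq fun q =>
      ⟨fun h => by casesm* _ ∧ _; constructor <;> assumption,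
        fun h => ⟨h.isLawful, h.codeClause, h.isMarked, h.not_forall_codedTruth⟩⟩ <;>
  simp only [codedFrame, CodedTruth, IsMarked, Fin.forall_iff] <;>
  repeat' with_reducible first
    | exact Primrec.const _
    | exact Primrec.id
    | exact Primrec.fst
    | exact Primrec.snd
    | apply PrimrecPred.and
    | apply PrimrecPred.not
    | apply primrecPred_forall_lt
    | apply primrecPred_bitRel
    | apply primrecPred_mem_ofNat_list
    | apply primrecPred_iff
    | apply primrecPred_imp
    | apply Primrec.eq.comp
    | apply primrec_stateBound
    | apply Primrec₂.natPair.comp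
    | apply Primrec.fst.comp
    | apply Primrec.snd.comp
    | apply Primrec.succ.comp

section Coded

variable {Var : Type u} {Pred : Type v} {ar : Pred → ℕ} [Encodable Var]

/-- The frame coded by `m`, on the variables themselves. Only the codes of lists of codes of
variables are kept as indices. -/
def decodedFrame (Var : Type u) [Encodable Var] (n m : ℕ) :
    RelFrame {l : Fin (n + 1) // ∀ k ∈ Denumerable.ofNat (List ℕ) l,
      ∃ x : Var, Encodable.encode x = k} Var (Fin (stateBound n)) :=
  (codedFrame n m).comap Subtype.val (fun x k => Encodable.encode x = k.1)
    (fun x l => Encodable.encode x ∈ Denumerable.ofNat (List ℕ) l.1)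
    ⟨0, fun _ h => absurd (lt_of_mem_ofNat_list h) (Nat.not_lt_zero _)⟩

variable [Encodable Pred]

theorem CodeClause.isMarked_of_mem_children {n m : ℕ} {φ ψ : Formula Var Pred ar}
    (hφ : φ.code < n + 1) (h : CodeClause n m φ.code) (hψ : ψ ∈ φ.children) :
    IsMarked m ψ.code := by
  have lt_of_mem {ψ} (hψ : ψ ∈ φ.children) : ψ.code < n + 1 :=
    (code_le_code_of_mem_children hψ).trans_lt hφ
  have source_lt : φ.sourceCode < n + 1 := φ.sourceCode_le_code.trans_lt hφ
  cases φ with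
  | neg φ => exact hψ ▸ (h.neg ⟨_, lt_of_mem rfl⟩ rfl).1
  | and φ φ' =>
    have := h.and ⟨_, lt_of_mem (.inl rfl)⟩ ⟨_, lt_of_mem (.inr rfl)⟩ rfl
    rcases hψ with rfl | rfl
    exacts [this.1, this.2.1]
  | dmod X φ => exact hψ ▸ (h.dmod ⟨_, source_lt⟩ ⟨_, lt_of_mem rfl⟩ rfl).1
  | kmod X φ => exact hψ ▸ (h.kmod ⟨_, source_lt⟩ ⟨_, lt_of_mem rfl⟩ rfl).1
  | atom | ddep | kdep => exact absurd hψ (Set.notMem_empty _)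

theorem forall_fin_of_pair_eq {N k a b : ℕ} {r : Fin N → Fin N → Prop}
    (h : ∀ ha hb, r ⟨a, ha⟩ ⟨b, hb⟩) (p q : Fin N)
    (hpq : Nat.pair k (Nat.pair a b) = Nat.pair k (Nat.pair p q)) : r p q := by
  simp only [Nat.pair_eq_pair, true_and] at hpq
  obtain ⟨rfl, rfl⟩ := hpq
  exact h p.2 q.2

theorem codeClause_of_truthClause {n m : ℕ} {F : RelFrame (Fin (n + 1)) Var (Fin (stateBound n))}
    {tr : Fin (stateBound n) → Formula Var Pred ar → Prop}
    (hF : codedFrame n m = F.comap id (fun k x => Encodable.encode x = k.1)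
      (fun k l => k.1 ∈ Denumerable.ofNat (List ℕ) l) 0)
    (htr : ∀ (i : Fin (stateBound n)) φ, φ.code < n + 1 → (CodedTruth m i φ.code ↔ tr i φ))
    (hmark : ∀ φ : Formula Var Pred ar, φ.code < n + 1 → IsMarked m φ.code)
    {φ : Formula Var Pred ar} (hφ : φ.code < n + 1)
    (h : F.TruthClause tr ⟨φ.sourceCode, φ.sourceCode_le_code.trans_lt hφ⟩ φ) :
    CodeClause n m φ.code := by
  have eqv_iff {l i j} : (codedFrame n m).eqv l i j ↔ F.eqv l i j := by rw [hF]; rfl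
  have le_iff {l i j} : (codedFrame n m).le l i j ↔ F.le l i j := by rw [hF]; rfl
  have htrφ i := htr i φ hφ
  constructor <;> cases φ <;> try solve | simp [code]
  case atom.atom =>
    exact forall_fin_of_pair_eq fun _ _ i j hij hi =>
      (htrφ j).2 (h i j (eqv_iff.1 hij) ((htrφ i).1 hi))
  case neg.neg φ =>
    rintro ⟨_, hd⟩ hc
    obtain ⟨-, rfl⟩ := Nat.pair_eq_pair.1 hc
    exact ⟨hmark φ hd, fun i => (htrφ i).trans ((h i).trans (not_congr (htr i φ hd).symm))⟩
  case and.and φ ψ =>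
    exact forall_fin_of_pair_eq fun hd he => ⟨hmark φ hd, hmark ψ he,
      fun i => (htrφ i).trans ((h i).trans (and_congr (htr i φ hd) (htr i ψ he)).symm)⟩
  case dmod.dmod X φ =>
    exact forall_fin_of_pair_eq fun _ hd => ⟨hmark φ hd, fun i => (htrφ i).trans
      ((h i).trans (forall_congr' fun j => imp_congr eqv_iff (htr j φ hd)).symm)⟩
  case kmod.kmod X φ =>
    exact forall_fin_of_pair_eq fun _ hd => ⟨hmark φ hd, fun i => (htrφ i).trans
      ((h i).trans (forall_congr' fun j => imp_congr le_iff (htr j φ hd)).symm)⟩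
  case ddep.ddep | kdep.kdep =>
    rw [hF]
    exact forall_fin_of_pair_eq fun _ hY i =>
      (htrφ i).trans ((h i).trans (forall_encode_eq_of_mem_ofNat_iff hY).symm)

theorem exists_bitRel_iff (N : ℕ) (Q : ℕ → ℕ → ℕ → ℕ → Prop) :
    ∃ m < 2 ^ Nat.pair 6 (Nat.pair N (Nat.pair N N)),
      ∀ k < 6, ∀ x < N, ∀ y < N, ∀ z < N, bitRel m k x y z ↔ Q k x y z := by
  classical
  let f (i : Fin (Nat.pair 6 (Nat.pair N (Nat.pair N N)))) : Bool :=
    decide (Q i.1.unpair.1 i.1.unpair.2.unpair.1 i.1.unpair.2.unpair.2.unpair.1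
      i.1.unpair.2.unpair.2.unpair.2)
  refine ⟨Nat.ofBits f, Nat.ofBits_lt_two_pow f, fun k hk x hx y hy z hz => ?_⟩
  have pair_lt_pair {a b c d : ℕ} (h : a < c) (h' : b < d) : Nat.pair a b < Nat.pair c d :=
    (Nat.pair_lt_pair_left _ h).trans (Nat.pair_lt_pair_right _ h')
  rw [bitRel, Nat.testBit_ofBits_lt _ _ (pair_lt_pair hk (pair_lt_pair hx (pair_lt_pair hy hz)))]
  simp only [f, Nat.unpair_pair, decide_eq_true_iff]

theorem exists_codedFrame_eq {n : ℕ}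
    (eqv le : Fin (n + 1) → Fin (stateBound n) → Fin (stateBound n) → Prop)
    (dD dK : Fin (stateBound n) → Fin (n + 1) → Fin (n + 1) → Prop)
    (truth : Fin (stateBound n) → Fin (n + 1) → Prop) (mark : Fin (n + 1) → Prop) :
    ∃ m < 2 ^ bitBound n,
      codedFrame n m = ⟨fun y l => y.1 ∈ Denumerable.ofNat (List ℕ) l, 0, eqv, le, dD, dK⟩ ∧
      (∀ (i : Fin (stateBound n)) (c : Fin (n + 1)), CodedTruth m i c ↔ truth i c) ∧
      ∀ c : Fin (n + 1), IsMarked m c ↔ mark c := by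
  have : NeZero (stateBound n) := ⟨(Nat.two_pow_pos _).ne'⟩
  obtain ⟨m, hm, h⟩ := exists_bitRel_iff (stateBound n + (n + 1)) fun k x y z => match k with
    | 0 => eqv (.ofNat _ x) (.ofNat _ y) (.ofNat _ z)
    | 1 => le (.ofNat _ x) (.ofNat _ y) (.ofNat _ z)
    | 2 => dD (.ofNat _ x) (.ofNat _ y) (.ofNat _ z)
    | 3 => dK (.ofNat _ x) (.ofNat _ y) (.ofNat _ z)
    | 4 => truth (.ofNat _ x) (.ofNat _ y)
    | _ => mark (.ofNat _ x)
  have world_lt (i : Fin (stateBound n)) : i.1 < stateBound n + (n + 1) := by omega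
  have code_lt (c : Fin (n + 1)) : c.1 < stateBound n + (n + 1) := by omega
  have zero_lt : 0 < stateBound n + (n + 1) := code_lt 0
  refine ⟨m, hm, ?_, fun i c => ?_, fun c => ?_⟩
  · simp only [codedFrame, RelFrame.mk.injEq]
    simp only [funext_iff]
    simp [h, world_lt, code_lt]
  · simpa [CodedTruth] using h 4 (by decide) i (world_lt i) c (code_lt c) 0 zero_lt
  · simpa [IsMarked] using h 5 (by decide) c (code_lt c) 0 zero_lt 0 zero_lt

/-- The variables with code at most `n`. -/
noncomputable def boundedVars (Var : Type u) [Encodable Var] (n : ℕ) : Finset Var :=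
  (Finset.range (n + 1)).preimage Encodable.encode Encodable.encode_injective.injOn

/-- The variables with code at most `n` whose codes are in the list coded by `l`. -/
noncomputable def decodedVars (Var : Type u) [Encodable Var] (n l : ℕ) : Finset Var :=
  (boundedVars Var n).filter fun x => Encodable.encode x ∈ Denumerable.ofNat (List ℕ) l

/-- The formulas with code at most `n`. -/
def boundedFormulas (Var : Type u) {Pred : Type v} (ar : Pred → ℕ) [Encodable Var] [Encodable Pred]
    (n : ℕ) : Set (Formula Var Pred ar) :=
  {φ | φ.code < n + 1}

theorem mem_boundedVars {n : ℕ} {x : Var} : x ∈ boundedVars Var n ↔ Encodable.encode x < n + 1 := by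
  simp [boundedVars]

theorem card_boundedVars_le (n : ℕ) : (boundedVars Var n).card ≤ n + 1 :=
  (Finset.card_le_card_of_injOn Encodable.encode
    (fun _ hx => Finset.mem_coe.2 (Finset.mem_range.2 (mem_boundedVars.1 hx)))
    Encodable.encode_injective.injOn).trans_eq (Finset.card_range _)

theorem decodedVars_zero (n : ℕ) : decodedVars Var n 0 = ∅ :=
  Finset.filter_eq_empty_iff.2 fun _ _ h => Nat.not_lt_zero _ (lt_of_mem_ofNat_list h)

theorem mem_decodedVars_iff {n : ℕ} {l : Fin (n + 1)} {x : Var} :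
    x ∈ decodedVars Var n l ↔
      ∃ k : Fin (n + 1), k.1 ∈ Denumerable.ofNat (List ℕ) l ∧ Encodable.encode x = k := by
  rw [decodedVars, Finset.mem_filter, mem_boundedVars]
  exact ⟨fun h => ⟨⟨_, h.1⟩, h.2, rfl⟩, fun ⟨k, hk, hx⟩ => hx ▸ ⟨k.2, hk⟩⟩

theorem finite_boundedFormulas (ar : Pred → ℕ) (n : ℕ) : (boundedFormulas Var ar n).Finite :=
  (Set.finite_Iio (n + 1)).preimage code_injective.injOn

theorem ncard_boundedFormulas_le (ar : Pred → ℕ) (n : ℕ) :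
    (boundedFormulas Var ar n).ncard ≤ n + 1 := by
  rw [← Finset.card_range (n + 1), ← Set.ncard_coe_finset]
  exact Set.ncard_le_ncard_of_injOn code (fun φ hφ => Finset.mem_coe.2 (Finset.mem_range.2 hφ))
    code_injective.injOn

theorem exists_isCanonicalFamily_bounded [DecidableEq Var] {φ : Formula Var Pred ar}
    (hφ : ¬ Provable φ) {n : ℕ} (hφn : φ.code < n + 1) :
    ∃ g : Fin (stateBound n) → Set (Formula Var Pred ar),
      IsCanonicalFamily (filtrationSet (boundedVars Var n)
        (fun l : Fin (n + 1) => decodedVars Var n l) (boundedFormulas Var ar n)) g ∧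
      ∃ a, φ ∉ g a := by
  refine exists_isCanonicalFamily (finite_filtrationSet _ _ (finite_boundedFormulas ar _))
    (Nat.pow_le_pow_right two_pos ((ncard_filtrationSet_le _ _ _).trans ?_))
    (.inl hφn) hφ
  rw [Nat.card_fin]
  gcongr
  exacts [ncard_boundedFormulas_le ar _, card_boundedVars_le _]

variable [DecidableEq Var]

theorem CodeClause.exists_truthClause {n m : ℕ} {φ : Formula Var Pred ar} (hφ : φ.code < n + 1)
    (h : CodeClause n m φ.code) : ∃ β, (∀ x, (decodedFrame Var n m).mem x β ↔ x ∈ φ.source) ∧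
      (decodedFrame Var n m).TruthClause (fun i φ => CodedTruth m i φ.code) β φ := by
  refine ⟨⟨⟨φ.sourceCode, φ.sourceCode_le_code.trans_lt hφ⟩, fun k hk =>
    have ⟨x, _, hx⟩ := mem_ofNat_sourceCode.1 hk; ⟨x, hx⟩⟩, fun x => ?_, ?_⟩
  · exact mem_ofNat_sourceCode.trans (by simp only [Encodable.encode_inj, exists_eq_right])
  let child (ψ : Formula Var Pred ar) (hψ : ψ ∈ φ.children) : Fin (n + 1) :=
    ⟨ψ.code, (code_le_code_of_mem_children hψ).trans_lt hφ⟩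
  let source : Fin (n + 1) := ⟨φ.sourceCode, φ.sourceCode_le_code.trans_lt hφ⟩
  cases φ with
  | atom P xs =>
    exact h.atom ⟨_, ((Nat.left_le_pair _ _).trans (Nat.right_le_pair _ _)).trans_lt hφ⟩ source rfl
  | neg φ => exact (h.neg (child φ rfl) rfl).2
  | and φ ψ => exact (h.and (child φ (.inl rfl)) (child ψ (.inr rfl)) rfl).2.2
  | dmod X φ => exact (h.dmod source (child φ rfl) rfl).2
  | kmod X φ => exact (h.kmod source (child φ rfl) rfl).2
  | ddep X Y =>
    have hY := ((Nat.right_le_pair _ _).trans (Nat.right_le_pair _ _)).trans_lt hφ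
    exact fun i => (h.ddep source ⟨_, hY⟩ rfl i).trans (forall_mem_ofNat_encode_finset)
  | kdep X Y =>
    have hY := ((Nat.right_le_pair _ _).trans (Nat.right_le_pair _ _)).trans_lt hφ
    exact fun i => (h.kdep source ⟨_, hY⟩ rfl i).trans (forall_mem_ofNat_encode_finset)

theorem CodeRefutes.isPremodel_decodedFrame {n m : ℕ} (h : CodeRefutes n m) :
    (decodedFrame Var n m).IsPremodel (fun i φ => CodedTruth m i φ.code)
      {φ : Formula Var Pred ar | φ.code < n + 1 ∧ IsMarked m φ.code} where
  isLawful := h.isLawful.comap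
    (fun _ l => ⟨fun hy => have ⟨x, hx⟩ := l.2 _ hy; ⟨x, hx ▸ hy, hx⟩,
      fun ⟨_, hx, hxy⟩ => by rwa [hxy] at hx⟩) rfl
    fun _ h => absurd (lt_of_mem_ofNat_list h) (Nat.not_lt_zero _)
  closed _ hφ _ hψ := ⟨(code_le_code_of_mem_children hψ).trans_lt hφ.1,
    (h.codeClause _ hφ.1 hφ.2).isMarked_of_mem_children hφ.1 hψ⟩
  truthClause _ hφ := (h.codeClause _ hφ.1 hφ.2).exists_truthClause hφ.1

theorem decodedVars_sourceCode {n : ℕ} {φ : Formula Var Pred ar} (hφ : φ.code < n + 1) :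
    decodedVars Var n φ.sourceCode = φ.source := by
  ext x
  simp only [decodedVars, Finset.mem_filter, mem_boundedVars, mem_ofNat_sourceCode,
    Encodable.encode_inj, exists_eq_right, and_iff_right_iff_imp]
  exact fun hx => (encode_lt_code_of_mem_source hx).trans hφ

theorem exists_codeRefutes_of_not_provable {φ : Formula Var Pred ar} (hφ : ¬ Provable φ) :
    ∃ m < 2 ^ bitBound φ.code, CodeRefutes φ.code m := by
  let n := φ.code
  obtain ⟨g, hg, a, ha⟩ := exists_isCanonicalFamily_bounded hφ (Nat.lt_succ_self n)
  let ι := fun l : Fin (n + 1) => decodedVars Var n l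
  have hι (l) : ι l ⊆ boundedVars Var n := Finset.filter_subset _ _
  let F := canonicalFrame (boundedVars Var n) ι 0
    (filtrationSet (boundedVars Var n) ι (boundedFormulas Var ar n)) g
  let F' := F.comap id (fun (k : Fin (n + 1)) x => Encodable.encode x = k.1)
    (fun k l => k.1 ∈ Denumerable.ofNat (List ℕ) l) 0
  obtain ⟨m, hm, hF, htr, hmark⟩ := exists_codedFrame_eq F'.eqv F'.le F'.dD F'.dK
    (fun i c => ∃ ψ : Formula Var Pred ar, ψ.code = c ∧ ψ ∈ g i)
    (fun c => ∃ ψ : Formula Var Pred ar, ψ.code = c)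
  have codedTruth_iff (i : Fin (stateBound n)) (ψ : Formula Var Pred ar) (hψ : ψ.code < n + 1) :
      CodedTruth m i ψ.code ↔ ψ ∈ g i :=
    (htr i ⟨_, hψ⟩).trans ⟨fun ⟨_, h, hi⟩ => code_injective h ▸ hi, fun hi => ⟨ψ, rfl, hi⟩⟩
  have isMarked_code (ψ : Formula Var Pred ar) (hψ : ψ.code < n + 1) : IsMarked m ψ.code :=
    (hmark ⟨_, hψ⟩).2 ⟨ψ, rfl⟩
  refine ⟨m, hm, ?_, fun c hc hc' => ?_, isMarked_code φ (Nat.lt_succ_self _), fun h =>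
    ha ((codedTruth_iff a φ (Nat.lt_succ_self _)).1 (h a))⟩
  · rw [hF]
    exact (isLawful_canonicalFrame (empty := (0 : Fin (n + 1))) hg hι (decodedVars_zero n)).comap
      (f := id) (fun _ _ => mem_decodedVars_iff) rfl
      fun _ h => absurd (lt_of_mem_ofNat_list h) (Nat.not_lt_zero _)
  · obtain ⟨ψ, rfl⟩ := (hmark ⟨c, hc⟩).1 hc'
    exact codeClause_of_truthClause (F := F) hF codedTruth_iff isMarked_code hc
      (truthClause_canonicalFrame hg hι hc
        (fun _ hα => (code_le_code_of_mem_children hα).trans_lt hc)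
        (fun _ hx => mem_boundedVars.2 ((encode_lt_code_of_mem_target hx).trans hc))
        (decodedVars_sourceCode hc))

end Coded

section Decidable

variable {Var : Type u} {Pred : Type v} {ar : Pred → ℕ} [Encodable Var] [Encodable Pred]

theorem CodeRefutes.not_validTopo {φ : Formula Var Pred ar} {m : ℕ}
    (h : CodeRefutes φ.code m) : ¬ ValidTopo.{u, v, w, w'} φ := by
  classical
  obtain ⟨i, hi⟩ := not_forall.1 h.not_forall_codedTruth
  obtain ⟨M, -, hM⟩ := h.isPremodel_decodedFrame.exists_metricDepModel.{u, v, w, w'}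
    (tag := Encodable.encode) (fun _ _ _ _ _ hxy => Encodable.encode_injective.comp_left hxy)
    ⟨Nat.lt_succ_self _, h.isMarked⟩ hi
  exact fun hv => hM (hv M.toTopoDepModel)

theorem exists_computable_validTopo (ar : Pred → ℕ) : ∃ f : ℕ → Bool, Computable f ∧
    ∀ φ : Formula Var Pred ar, f φ.code = true ↔ ValidTopo.{u, v, w, w'} φ := by
  classical
  have hp : PrimrecPred fun n => ∀ m < 2 ^ bitBound n, ¬ CodeRefutes n m :=
    primrecPred_forall_lt (primrec_two_pow (primrec_bitBound .id)) primrecPred_codeRefutes.not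
  refine ⟨fun n => decide (∀ m < 2 ^ bitBound n, ¬ CodeRefutes n m), hp.decide.to_comp,
    fun φ => decide_eq_true_iff.trans ⟨fun h => ?_, fun h m _ hm => hm.not_validTopo h⟩⟩
  by_contra hφ
  obtain ⟨m, hm, hm'⟩ := exists_codeRefutes_of_not_provable (mt provable_iff_validTopo.1 hφ)
  exact h m hm hm'

end Decidable

end LCD

theorem mainTheorem1 {Var : Type u} {Pred : Type v} [DecidableEq Var]
    (ar : Pred → ℕ) :
    (∀ φ : LCD.Formula Var Pred ar, LCD.Provable φ ↔ LCD.ValidTopo.{u, v, w, w'} φ) ∧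
    (∀ φ : LCD.Formula Var Pred ar, LCD.Provable φ ↔ LCD.ValidMetric.{u, v, w, w'} φ) ∧
    (∀ φ : LCD.Formula Var Pred ar, LCD.Provable φ ↔ LCD.ValidConcrete.{u, v, w} φ) ∧
    (∀ φ : LCD.Formula Var Pred ar,
      LCD.Provable φ ↔ LCD.ValidPseudoLocallyLipschitz.{u, v, w, w'} φ) ∧
    (∀ [Encodable Var] [Encodable Pred],
      ∃ f : ℕ → Bool, Computable f ∧
        ∀ φ : LCD.Formula Var Pred ar,
          f φ.code = true ↔ LCD.ValidTopo.{u, v, w, w'} φ) :=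
  ⟨fun _ => LCD.provable_iff_validTopo, fun _ => LCD.provable_iff_validMetric,
    fun _ => LCD.provable_iff_validConcrete,
    fun _ => LCD.provable_iff_validPseudoLocallyLipschitz, LCD.exists_computable_validTopo ar⟩
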